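/- Let $n\ge 0$ and let $(M,\eta)$ be a contact manifold of dimension $2n+1$, i.e. $M$ is a smooth manifold and $\eta$ is a smooth $1$-form on $M$ such that $(\mathsf d\eta)^n\wedge\eta$ vanishes nowhere. Let $\xi$ be its Reeb vector field, characterized by $i_\xi\mathsf d\eta=0$ and $i_\xi\eta=1$. For a smooth function $H:M\to\mathbb R$ let $X_H$ be the contact vector field of $H$, characterized by $$i_{X_H}\mathsf d\eta=-\mathsf dH+\xi(H)\,\eta,\qquad i_{X_H}\eta=H .$$ Suppose that $0$ is a regular value of $H$ and that $\xi(H)(p)\neq 0$ for every $p\in M_0:=H^{-1}(0)$. Let $M_1:=M\setminus M_0$, an open submanifold of $M$, and let $\mathfrak i_0:M_0\to M$ and $\mathfrak i_1:M_1\to M$ be the inclusions. Then: 1. $M_0$ is a $2n$-dimensional regular (embedded) submanifold of $M$, and, with $\eta_0:=\mathfrak i_0^*\eta$, the pair $(M_0,\mathsf d\eta_0)$ is a symplectic manifold, where $\mathsf d\eta_0=\mathfrak i_0^*\mathsf d\eta$. Moreover, $M_0$ is $X_H$-invariant, i.e. $X_H(p)\in T_pM_0$ for all $p\in M_0$; in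 particular, there exists a smooth vector field $Y$ on $M_0$ such that $\mathfrak i_{0*}\circ Y=X_H\circ\mathfrak i_0$. 2. With $\eta_1:=\mathfrak i_1^*\eta$, the pair $(M_1,\eta_1)$ is a contact manifold and, with $H_1:=\mathfrak i_1^*H$ and $X_{H_1}$ the contact vector field of $H_1$ with respect to $\eta_1$, one has $\mathfrak i_{1*}\circ X_{H_1}=X_H\circ\mathfrak i_1$. -/

import Mathlib

open scoped Manifold ContDiff Topology TensorProduct

noncomputable section

namespace ContactGeometry

/-! ## Linear algebra: the wedge product of alternating forms -/

section Linear

variable {V : Type*} [AddCommGroup V] [Module ℝ V]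

/-- The wedge product of an alternating `k`-form and an alternating `l`-form
(the signed sum over `(k,l)`-shuffles). -/
def wedge {k l : ℕ} (a : V [⋀^Fin k]→ₗ[ℝ] ℝ) (b : V [⋀^Fin l]→ₗ[ℝ] ℝ) :
    V [⋀^Fin (k + l)]→ₗ[ℝ] ℝ :=
  ((LinearMap.mul' ℝ ℝ).compAlternatingMap (a.domCoprod b)).domDomCongr finSumFinEquiv

/-- The `n`-fold wedge power `α ∧ ⋯ ∧ α` of a `2`-form, a `2 * n`-form;
the empty power is the constant `0`-form `1`. -/
def wedgePow (α : V [⋀^Fin 2]→ₗ[ℝ] ℝ) : (n : ℕ) → V [⋀^Fin (2 * n)]→ₗ[ℝ] ℝ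
  | 0 => (AlternatingMap.constOfIsEmpty ℝ V (Fin 0) 1 : V [⋀^Fin 0]→ₗ[ℝ] ℝ)
  | n + 1 => wedge (wedgePow α n) α

/-- If `a` and `b` vanish on all tuples containing `v`, so does `a ∧ b`. -/
theorem wedge_eq_zero_of_mem {k l : ℕ} {a : V [⋀^Fin k]→ₗ[ℝ] ℝ} {b : V [⋀^Fin l]→ₗ[ℝ] ℝ} {v : V}
    (ha : ∀ u : Fin k → V, (∃ i, u i = v) → a u = 0)
    (hb : ∀ u : Fin l → V, (∃ i, u i = v) → b u = 0)
    (u : Fin (k + l) → V) (hu : ∃ i, u i = v) : wedge a b u = 0 := by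
  obtain ⟨i, hi⟩ := hu
  rw [wedge, AlternatingMap.domDomCongr_apply, LinearMap.compAlternatingMap_apply,
    AlternatingMap.domCoprod_apply, sum_apply, map_sum]
  refine Finset.sum_eq_zero fun σ _ => ?_
  induction σ using Quotient.inductionOn' with | _ σ
  rw [AlternatingMap.domCoprod.summand_mk'']
  have key : a (fun j => u (finSumFinEquiv (σ (Sum.inl j)))) *
      b (fun j => u (finSumFinEquiv (σ (Sum.inr j)))) = 0 := by
    rcases h : σ.symm (finSumFinEquiv.symm i) with j | j
    · rw [ha _ ⟨j, by rw [← h]; simpa using hi⟩, zero_mul]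
    · rw [hb _ ⟨j, by rw [← h]; simpa using hi⟩, mul_zero]
  change LinearMap.mul' ℝ ℝ (Equiv.Perm.sign σ •
    (a (fun j => u (finSumFinEquiv (σ (Sum.inl j)))) ⊗ₜ[ℝ]
      b (fun j => u (finSumFinEquiv (σ (Sum.inr j)))))) = 0
  rw [Units.smul_def, map_zsmul, LinearMap.mul'_apply, key, smul_zero]

/-- If `α^n ∧ β ≠ 0` in dimension `2n+1`, then `ker α ∩ ker β = 0`. -/
theorem eq_zero_of_wedge_ne_zero {n : ℕ} (hV : Module.finrank ℝ V = 2 * n + 1)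
    {α : V [⋀^Fin 2]→ₗ[ℝ] ℝ} {β : V [⋀^Fin 1]→ₗ[ℝ] ℝ}
    (h : wedge (wedgePow α n) β ≠ 0) {v : V}
    (hα : ∀ w, α ![v, w] = 0) (hβ : β ![v] = 0) : v = 0 := by
  by_contra hv
  apply h
  have hα' : ∀ u : Fin 2 → V, (∃ i, u i = v) → α u = 0 := by
    rintro u ⟨i, hi⟩
    have hu : u = ![u 0, u 1] := by ext j; fin_cases j <;> rfl
    fin_cases i
    · have hi : u 0 = v := hi
      rw [hu, hi, hα]
    · have hi : u 1 = v := hi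
      have h2 := α.map_swap ![v, u 0] (i := 0) (j := 1) (by decide)
      rw [hα, neg_zero] at h2
      rw [← h2, hu, hi]
      congr 1
      ext j; fin_cases j <;> simp
  have hβ' : ∀ u : Fin 1 → V, (∃ i, u i = v) → β u = 0 := by
    rintro u ⟨i, hi⟩
    rw [← hβ]
    congr 1
    ext j
    rw [Subsingleton.elim j i, hi, Subsingleton.elim i 0]; rfl
  have hpow : ∀ k, ∀ u : Fin (2 * k) → V, (∃ i, u i = v) → wedgePow α k u = 0 := by
    intro k
    induction k with
    | zero => rintro u ⟨i, -⟩; exact (Fin.elim0 (i : Fin 0))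
    | succ k ih => exact wedge_eq_zero_of_mem ih hα'
  have hfin : FiniteDimensional ℝ V := FiniteDimensional.of_finrank_pos (by omega)
  have hli : LinearIndepOn ℝ id {v} := (LinearIndepOn.singleton hv)
  let b := Module.Basis.extend hli
  have hvmem : v ∈ hli.extend (Set.subset_univ _) := hli.subset_extend _ rfl
  have : Fintype (hli.extend (Set.subset_univ {v})) := FiniteDimensional.fintypeBasisIndex b
  refine b.ext_alternating fun f hf => ?_
  have hsurj : Function.Surjective f :=
    ((Fintype.bijective_iff_injective_and_card f).2 ⟨hf, by
      rw [← Module.finrank_eq_card_basis b, hV, Fintype.card_fin]⟩).2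
  obtain ⟨i, hi⟩ := hsurj ⟨v, hvmem⟩
  simp only [AlternatingMap.zero_apply]
  exact wedge_eq_zero_of_mem (hpow n) hβ' _ ⟨i, by rw [hi]; simp [b]⟩

/-- A skew-symmetric bilinear form in odd dimension is degenerate. -/
theorem exists_ne_zero_kernel {n : ℕ} (hV : Module.finrank ℝ V = 2 * n + 1)
    (B : V →ₗ[ℝ] V →ₗ[ℝ] ℝ) (hB : ∀ v w, B v w = -B w v) : ∃ v, v ≠ 0 ∧ B v = 0 := by
  have hfin : FiniteDimensional ℝ V := FiniteDimensional.of_finrank_pos (by omega)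
  let b := Module.finBasis ℝ V
  let A : Matrix _ _ ℝ := Matrix.of fun i j => B (b i) (b j)
  have hA : A.transpose = -A := by ext i j; exact hB _ _
  have hdet : A.det = 0 := by
    have h1 : A.det = -A.det := by
      conv_lhs => rw [← Matrix.det_transpose, hA, Matrix.det_neg, Fintype.card_fin]
      rw [Odd.neg_one_pow ⟨n, hV⟩, neg_one_mul]
    linarith
  obtain ⟨c, hc, hc0⟩ := Matrix.exists_vecMul_eq_zero_iff.2 hdet
  refine ⟨∑ i, c i • b i, fun h0 => hc ?_, ?_⟩
  · ext i
    exact Fintype.linearIndependent_iff.1 b.linearIndependent c h0 i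
  · refine b.ext fun j => ?_
    have := congrFun hc0 j
    simpa [Matrix.vecMul, dotProduct, A] using this

/-- If `α^n ∧ β ≠ 0` in dimension `2n+1`, then there is a Reeb vector `x`, and the equations
`i_v α = γ - γ(x) β`, `i_v β = c` have exactly one solution `v`. -/
theorem existsUnique_of_wedge_ne_zero {n : ℕ} (hV : Module.finrank ℝ V = 2 * n + 1)
    {α : V [⋀^Fin 2]→ₗ[ℝ] ℝ} {β : V [⋀^Fin 1]→ₗ[ℝ] ℝ}
    (h : wedge (wedgePow α n) β ≠ 0) :
    ∃ x : V, ((∀ w, α ![x, w] = 0) ∧ β ![x] = 1) ∧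
      ∀ (γ : V →ₗ[ℝ] ℝ) (c : ℝ), ∃! v : V, (∀ w, α ![v, w] = γ w - γ x * β ![w]) ∧ β ![v] = c := by
  have hfin : FiniteDimensional ℝ V := FiniteDimensional.of_finrank_pos (by omega)
  have e : ∀ x y : V, Function.update ![x] 0 y = ![y] := by
    intro x y; ext j; fin_cases j; simp
  let L : V →ₗ[ℝ] ℝ :=
    { toFun := fun v => β ![v]
      map_add' := fun x y => by
        have := β.map_update_add ![(0 : V)] 0 x y
        rwa [e, e, e] at this
      map_smul' := fun c x => by
        have := β.map_update_smul ![(0 : V)] 0 c x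
        rwa [e, e] at this }
  have e0 : ∀ x y z : V, Function.update ![x, y] 0 z = ![z, y] := by
    intro x y z; ext j; fin_cases j <;> simp
  have e1 : ∀ x y z : V, Function.update ![x, y] 1 z = ![x, z] := by
    intro x y z; ext j; fin_cases j <;> simp
  let B : V →ₗ[ℝ] V →ₗ[ℝ] ℝ := LinearMap.mk₂ ℝ (fun v w => α ![v, w])
    (fun x y z => by simpa [e0] using α.map_update_add ![(0 : V), z] 0 x y)
    (fun c x z => by simpa [e0] using α.map_update_smul ![(0 : V), z] 0 c x)
    (fun z x y => by simpa [e1] using α.map_update_add ![z, (0 : V)] 1 x y)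
    (fun c z x => by simpa [e1] using α.map_update_smul ![z, (0 : V)] 1 c x)
  have hBs : ∀ v w, B v w = -B w v := by
    intro v w
    have := α.map_swap ![w, v] (i := 0) (j := 1) (by decide)
    change α ![v, w] = - α ![w, v]
    rw [← this]
    congr 1
    ext j; fin_cases j <;> simp
  have hK : ∀ v, B v = 0 → L v = 0 → v = 0 := fun v h1 h2 =>
    eq_zero_of_wedge_ne_zero hV h (fun w => LinearMap.congr_fun h1 w) h2
  obtain ⟨z, hz, hBz⟩ := exists_ne_zero_kernel hV B hBs
  have hLz : L z ≠ 0 := fun h0 => hz (hK z hBz h0)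
  set x : V := (L z)⁻¹ • z with hx
  have hBx : B x = 0 := by rw [hx, map_smul, hBz, smul_zero]
  have hLx : L x = 1 := by rw [hx, map_smul, smul_eq_mul, inv_mul_cancel₀ hLz]
  refine ⟨x, ⟨fun w => LinearMap.congr_fun hBx w, hLx⟩, fun γ c => ?_⟩
  let F : V →ₗ[ℝ] V →ₗ[ℝ] ℝ := B + L.smulRight L
  have hF : ∀ v w, F v w = B v w + L v * L w := fun v w => by simp [F]
  have hinj : Function.Injective F := by
    rw [← LinearMap.ker_eq_bot, LinearMap.ker_eq_bot']
    intro v hv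
    have h1 : L v = 0 := by
      have := LinearMap.congr_fun hv x
      rw [hF, hBs, hBx, hLx] at this
      simpa using this
    refine hK v (LinearMap.ext fun w => ?_) h1
    have := LinearMap.congr_fun hv w
    rw [hF, h1] at this
    simpa using this
  have hsurj : Function.Surjective F :=
    (LinearMap.injective_iff_surjective_of_finrank_eq_finrank
      (by rw [Subspace.dual_finrank_eq (K := ℝ) (V := V)])).1 hinj
  obtain ⟨v, hv⟩ := hsurj (γ - γ x • L + c • L)
  have hvL : L v = c := by
    have := LinearMap.congr_fun hv x
    rw [hF, hBs, hBx] at this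
    simpa [hLx] using this
  refine ⟨v, ⟨fun w => ?_, hvL⟩, ?_⟩
  · have := LinearMap.congr_fun hv w
    rw [hF, hvL] at this
    have h3 : B v w = γ w - γ x * L w := by
      simp at this; linarith
    exact h3
  · rintro v' ⟨h1, h2⟩
    apply hinj
    rw [hv]
    ext w
    have h4 : B v' w = γ w - γ x * L w := h1 w
    have h5 : L v' = c := h2
    rw [hF, h4, h5]; simp

end Linear

/-! ## Differential forms on smooth manifolds without boundary -/

section Forms

variable {m : ℕ} {M : Type*} [TopologicalSpace M] [ChartedSpace (EuclideanSpace ℝ (Fin m)) M]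

variable (m M) in
/-- Differential `k`-forms on the `m`-dimensional manifold `M` (no regularity imposed). -/
abbrev DiffForm (k : ℕ) : Type _ :=
  (p : M) → (TangentSpace (𝓡 m) p) [⋀^Fin k]→L[ℝ] ℝ

/-- The expression of `α` in the chart at `p`: the pullback of `α` under the inverse of this chart,
a `k`-form on (the target of the chart in) `ℝ^m`. -/
def DiffForm.inChart {k : ℕ} (α : DiffForm m M k) (p : M) :
    EuclideanSpace ℝ (Fin m) → (EuclideanSpace ℝ (Fin m)) [⋀^Fin k]→L[ℝ] ℝ := fun y =>
  (α ((extChartAt (𝓡 m) p).symm y)).compContinuousLinearMap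
    (mfderiv 𝓘(ℝ, EuclideanSpace ℝ (Fin m)) (𝓡 m) (extChartAt (𝓡 m) p).symm y)

/-- A form is smooth if its expression in each chart `chartAt p` is smooth. -/
def DiffForm.IsSmooth {k : ℕ} (α : DiffForm m M k) : Prop :=
  ∀ p : M, ContDiffOn ℝ ∞ (α.inChart p) (extChartAt (𝓡 m) p).target

/-- The differential `dH` of a function, as a real-valued function of tangent vectors. -/
def differential (H : M → ℝ) (p : M) (v : TangentSpace (𝓡 m) p) : ℝ :=
  mfderiv (𝓡 m) 𝓘(ℝ, ℝ) H p v

/-- The exterior derivative `dα`. Its value at `p` is the exterior derivative of the expression of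
`α` in the chart at `p`, pulled back to `T_p M` by this chart. -/
def DiffForm.d {k : ℕ} (α : DiffForm m M k) : DiffForm m M (k + 1) := fun p =>
  (extDeriv (α.inChart p) (extChartAt (𝓡 m) p p)).compContinuousLinearMap
    (mfderiv (𝓡 m) 𝓘(ℝ, EuclideanSpace ℝ (Fin m)) (extChartAt (𝓡 m) p) p)

/-- The pullback `f^* α`. -/
def DiffForm.pullback {k l : ℕ} {N : Type*} [TopologicalSpace N]
    [ChartedSpace (EuclideanSpace ℝ (Fin l)) N] (f : N → M) (α : DiffForm m M k) :
    DiffForm l N k := fun q =>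
  (α (f q)).compContinuousLinearMap (mfderiv (𝓡 l) (𝓡 m) f q)

/-- `α` is a symplectic form: a smooth, closed and nondegenerate `2`-form. -/
structure IsSymplecticForm (α : DiffForm m M 2) : Prop where
  smooth : α.IsSmooth
  closed : α.d = 0
  nondegenerate : ∀ (p : M) (v : TangentSpace (𝓡 m) p),
    (∀ w : TangentSpace (𝓡 m) p, α p ![v, w] = 0) → v = 0

end Forms

/-! ## Contact manifolds -/

section Contact

variable {n : ℕ} {M : Type*} [TopologicalSpace M]
  [ChartedSpace (EuclideanSpace ℝ (Fin (2 * n + 1))) M]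

/-- `η` is a contact form on the `(2n+1)`-dimensional manifold `M`: a smooth `1`-form such that
`(dη)^n ∧ η` vanishes nowhere. -/
structure IsContactForm (η : DiffForm (2 * n + 1) M 1) : Prop where
  smooth : η.IsSmooth
  volume : ∀ p : M,
    wedge (wedgePow (η.d p).toAlternatingMap n) (η p).toAlternatingMap ≠ 0

/-- `v ∈ T_p M` is the value at `p` of the Reeb vector field: `i_v dη = 0` and `i_v η = 1`. -/
def IsReebVector (η : DiffForm (2 * n + 1) M 1) (p : M)
    (v : TangentSpace (𝓡 (2 * n + 1)) p) : Prop :=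
  (∀ w : TangentSpace (𝓡 (2 * n + 1)) p, η.d p ![v, w] = 0) ∧ η p ![v] = 1

/-- The Reeb vector field `ξ`, characterized by `i_ξ dη = 0` and `i_ξ η = 1`. -/
def reeb (η : DiffForm (2 * n + 1) M 1) (p : M) : TangentSpace (𝓡 (2 * n + 1)) p :=
  Classical.epsilon (IsReebVector η p)

/-- The function `ξ(H)`. -/
def reebDeriv (η : DiffForm (2 * n + 1) M 1) (H : M → ℝ) (p : M) : ℝ :=
  differential H p (reeb η p)

/-- `v ∈ T_p M` is the value at `p` of the contact vector field of `H`: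
`i_v dη = -dH + ξ(H) η` and `i_v η = H`. -/
def IsContactVector (η : DiffForm (2 * n + 1) M 1) (H : M → ℝ) (p : M)
    (v : TangentSpace (𝓡 (2 * n + 1)) p) : Prop :=
  (∀ w : TangentSpace (𝓡 (2 * n + 1)) p,
    η.d p ![v, w] = -differential H p w + reebDeriv η H p * η p ![w]) ∧
  η p ![v] = H p

/-- The contact vector field `X_H`, characterized by `i_{X_H} dη = -dH + ξ(H) η` and
`i_{X_H} η = H`. -/
def contactField (η : DiffForm (2 * n + 1) M 1) (H : M → ℝ) (p : M) :
    TangentSpace (𝓡 (2 * n + 1)) p :=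
  Classical.epsilon (IsContactVector η H p)

theorem finrank_tangentSpace (p : M) :
    Module.finrank ℝ (TangentSpace (𝓡 (2 * n + 1)) p) = 2 * n + 1 :=
  (finrank_euclideanSpace_fin : Module.finrank ℝ (EuclideanSpace ℝ (Fin (2 * n + 1))) = _)

/-- The Reeb vector field satisfies its defining equations. -/
theorem IsContactForm.isReebVector_reeb {η : DiffForm (2 * n + 1) M 1} (hη : IsContactForm η)
    (p : M) : IsReebVector η p (reeb η p) := by
  obtain ⟨x, hx, -⟩ := existsUnique_of_wedge_ne_zero
    (V := TangentSpace (𝓡 (2 * n + 1)) p) (finrank_tangentSpace p) (hη.volume p)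
  exact Classical.epsilon_spec (p := IsReebVector η p) ⟨x, hx⟩

/-- The Reeb vector field is the only solution of its defining equations. -/
theorem IsContactForm.eq_reeb {η : DiffForm (2 * n + 1) M 1} (hη : IsContactForm η)
    {p : M} {v : TangentSpace (𝓡 (2 * n + 1)) p} (hv : IsReebVector η p v) : v = reeb η p := by
  obtain ⟨x, -, hu⟩ := existsUnique_of_wedge_ne_zero
    (V := TangentSpace (𝓡 (2 * n + 1)) p) (finrank_tangentSpace p) (hη.volume p)
  have h2 := hη.isReebVector_reeb p
  exact (hu 0 1).unique ⟨fun w => (hv.1 w).trans (by simp), hv.2⟩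
    ⟨fun w => (h2.1 w).trans (by simp), h2.2⟩

/-- The equations defining the contact vector field have exactly one solution. -/
theorem IsContactForm.existsUnique_isContactVector {η : DiffForm (2 * n + 1) M 1}
    (hη : IsContactForm η) (H : M → ℝ) (p : M) : ∃! v, IsContactVector η H p v := by
  obtain ⟨x, hx, hu⟩ := existsUnique_of_wedge_ne_zero
    (V := TangentSpace (𝓡 (2 * n + 1)) p) (finrank_tangentSpace p) (hη.volume p)
  obtain rfl : x = reeb η p := hη.eq_reeb hx
  let γ : TangentSpace (𝓡 (2 * n + 1)) p →ₗ[ℝ] ℝ :=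
    { toFun := differential H p
      map_add' := map_add (mfderiv (𝓡 (2 * n + 1)) 𝓘(ℝ, ℝ) H p)
      map_smul' := map_smul (mfderiv (𝓡 (2 * n + 1)) 𝓘(ℝ, ℝ) H p) }
  have key : ∀ v : TangentSpace (𝓡 (2 * n + 1)) p, IsContactVector η H p v ↔
      (∀ w, η.d p ![v, w] = (-γ) w - (-γ) (reeb η p) * η p ![w]) ∧ η p ![v] = H p := by
    intro v
    refine and_congr_left' (forall_congr' fun w => ?_)
    have : ∀ w, (-γ) w = - differential H p w := fun w => rfl
    rw [this, this, neg_mul, sub_neg_eq_add]; rfl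
  obtain ⟨v, hv, hv'⟩ := hu (-γ) (H p)
  exact ⟨v, (key v).2 hv, fun w hw => hv' w ((key w).1 hw)⟩

/-- The contact vector field satisfies its defining equations. -/
theorem IsContactForm.isContactVector_contactField {η : DiffForm (2 * n + 1) M 1}
    (hη : IsContactForm η) (H : M → ℝ) (p : M) :
    IsContactVector η H p (contactField η H p) :=
  Classical.epsilon_spec (hη.existsUnique_isContactVector H p).exists

end Contact

/-! ## Submanifolds -/

section Submanifolds

/-- `M₀ = H⁻¹(0)`. -/
def zeroLocus {M : Type*} (H : M → ℝ) : Set M := {p | H p = 0}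

/-- `M₁ = M \ M₀`, an open submanifold of `M`. -/
def nonzeroLocus {M : Type*} [TopologicalSpace M] (H : M → ℝ) (hH : Continuous H) : TopologicalSpace.Opens M :=
  ⟨{p | H p ≠ 0}, isOpen_ne_fun hH continuous_const⟩

end Submanifolds

end ContactGeometry

end

open ContactGeometry

/-! The contact condition gives `ker dη ∩ ker η = 0`, so `v ↦ i_v dη + η(v) η` is invertible on each
tangent space. Tangency and nondegeneracy then follow from the contact equation at points with `H =
0`. Write `X = X_H`. Evaluating `i_X dη = -dH + ξ(H) η` on `X` gives `dH(X) = 0`, since `dη(X, X) =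
0` and `η(X) = H = 0`; thus `X` lies in `ker dH` (`differential_contactField`). If `v ∈ ker dH` is
`dη`-orthogonal to `ker dH`, testing against `X` gives `ξ(H) η(v) = 0`, so `η(v) = 0`. As `ξ` is
transverse to `ker dH` and `dη(v, ξ) = 0`, the form `dη(v, ·)` vanishes identically and `v = 0`
(`eq_zero_of_tangent`).

`M₀` gets its manifold structure from charts of `M` having `H` as a coordinate
(`exists_isSmoothEmbedding_zeroLocus`). For any structure making the inclusion a smooth embedding,
`T_q M₀ = ker dH` by a dimension count (`exists_mfderiv_val_eq_iff`). Smoothness and closedness of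
`dη₀` come from naturality of `d` and `d ∘ d = 0`, both reduced to `ℝ^m` through charts.

The field `Y` satisfies `i_Y dη₀ = ξ(H) η₀`. Solutions of smooth, uniquely solvable linear equations
are smooth (`contDiffAt_of_linear_equation`); the same principle applied to `i_ξ dη + η(ξ) η = η`
makes `ξ`, hence `ξ(H)`, smooth.

On `M₁` the inclusion has identity differential, so the restricted Reeb and contact vectors solve
the equations of `η₁`, and uniqueness identifies them. -/

namespace ContactGeometry

/-! ## Smoothness of algebraic operations on alternating forms -/

section Calculus

variable {D E F : Type*} [NormedAddCommGroup D] [NormedSpace ℝ D]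
  [NormedAddCommGroup E] [NormedSpace ℝ E] [NormedAddCommGroup F] [NormedSpace ℝ F]

/-- An injective linear map has a linear left inverse, which is continuous here because the space of
multilinear maps is finite-dimensional. It transfers smoothness from families of multilinear maps
back to families of alternating maps. -/
theorem exists_leftInverse_toContinuousMultilinearMap [FiniteDimensional ℝ E] (k : ℕ) :
    ∃ r : ContinuousMultilinearMap ℝ (fun _ : Fin k => E) ℝ →L[ℝ] E [⋀^Fin k]→L[ℝ] ℝ,
      ∀ α : E [⋀^Fin k]→L[ℝ] ℝ, r α.toContinuousMultilinearMap = α := by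
  have hfin : FiniteDimensional ℝ (ContinuousMultilinearMap ℝ (fun _ : Fin k => E) ℝ) :=
    FiniteDimensional.of_injective
      (ContinuousMultilinearMap.toMultilinearMapLinear :
        ContinuousMultilinearMap ℝ (fun _ : Fin k => E) ℝ →ₗ[ℝ] _)
      ContinuousMultilinearMap.toMultilinearMap_injective
  obtain ⟨r, hr⟩ := LinearMap.exists_leftInverse_of_injective
    (ContinuousAlternatingMap.toContinuousMultilinearMapCLM (𝕜 := ℝ) (E := E) (F := ℝ)
      (ι := Fin k) ℝ).toLinearMap
    (LinearMap.ker_eq_bot.2 ContinuousAlternatingMap.toContinuousMultilinearMap_injective)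
  exact ⟨LinearMap.toContinuousLinearMap r, fun α => LinearMap.congr_fun hr α⟩

/-- The pullback of a smooth family of forms by a smooth family of linear maps is smooth. -/
theorem contDiffAt_compContinuousLinearMap [FiniteDimensional ℝ E] {k : ℕ} {r : WithTop ℕ∞}
    {α : D → F [⋀^Fin k]→L[ℝ] ℝ} {g : D → E →L[ℝ] F} {x : D}
    (hα : ContDiffAt ℝ r α x) (hg : ContDiffAt ℝ r g x) :
    ContDiffAt ℝ r (fun y => (α y).compContinuousLinearMap (g y)) x := by
  obtain ⟨l, hl⟩ := exists_leftInverse_toContinuousMultilinearMap (E := E) k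
  -- Pullback of multilinear maps is linear in the form and continuous multilinear in the tuple of
  -- linear maps, here `(g y, …, g y)`; hence it is smooth jointly.
  have h1 : ContDiffAt ℝ r (fun y =>
      ContinuousMultilinearMap.compContinuousLinearMapContinuousMultilinear ℝ
        (fun _ : Fin k => E) (fun _ : Fin k => F) ℝ (fun _ => g y)) x :=
    (ContinuousMultilinearMap.contDiff _).contDiffAt.comp x (contDiffAt_pi.2 fun _ => hg)
  have h2 : ContDiffAt ℝ r (fun y => (α y).toContinuousMultilinearMap) x :=
    ContDiffAt.comp x (ContinuousAlternatingMap.toContinuousMultilinearMapCLM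
      (𝕜 := ℝ) (E := F) (F := ℝ) (ι := Fin k) ℝ).contDiff.contDiffAt hα
  refine (l.contDiff.contDiffAt.comp x (h1.clm_apply h2)).congr_of_eventuallyEq
    (Filter.Eventually.of_forall fun y => ?_)
  exact (hl _).symm

/-- The exterior derivative is a fixed continuous linear map, alternatization, applied to `fderiv`.
-/
theorem contDiffAt_extDeriv {k : ℕ} {α : E → E [⋀^Fin k]→L[ℝ] ℝ} {x : E}
    (hα : ContDiffAt ℝ ∞ α x) : ContDiffAt ℝ ∞ (extDeriv α) x :=
  ContDiffAt.comp (g := ContinuousAlternatingMap.alternatizeUncurryFinCLM ℝ E ℝ (n := k)) x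
    (ContinuousLinearMap.contDiff _).contDiffAt (hα.fderiv_right (m := ∞) (by simp))

/-- A basis of `E` identifies `E →L[ℝ] F` with a finite power of `F`, where smoothness is checked
componentwise. -/
theorem contDiffAt_clm_of_apply [FiniteDimensional ℝ E] {r : WithTop ℕ∞} {f : D → E →L[ℝ] F}
    {x : D} (h : ∀ v, ContDiffAt ℝ r (fun y => f y v) x) : ContDiffAt ℝ r f x := by
  let d := Module.finrank ℝ E
  have hd : d = Module.finrank ℝ (Fin d → ℝ) := (Module.finrank_fin_fun ℝ).symm
  let e₁ := ContinuousLinearEquiv.ofFinrankEq hd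
  let e₂ := (e₁.arrowCongr (1 : F ≃L[ℝ] F)).trans (ContinuousLinearEquiv.piRing (Fin d))
  rw [← Function.id_comp f, ← e₂.symm_comp_self]
  exact e₂.symm.contDiff.contDiffAt.comp x (contDiffAt_pi.mpr fun i => h _)

/-- The solution of a smooth family of uniquely solvable linear equations is smooth. -/
theorem contDiffAt_of_linear_equation [FiniteDimensional ℝ E] {r : WithTop ℕ∞}
    {A : D → E →L[ℝ] E →L[ℝ] ℝ} {b : D → E →L[ℝ] ℝ} {X : D → E} {x : D}
    (hA : ContDiffAt ℝ r A x) (hb : ContDiffAt ℝ r b x)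
    (hinj : ∀ v, A x v = 0 → v = 0) (hX : ∀ᶠ y in 𝓝 x, A y (X y) = b y) :
    ContDiffAt ℝ r X x := by
  have hdim : Module.finrank ℝ E = Module.finrank ℝ (E →L[ℝ] ℝ) := by
    have h := LinearEquiv.finrank_eq
      (LinearMap.toContinuousLinearMap : (E →ₗ[ℝ] ℝ) ≃ₗ[ℝ] E →L[ℝ] ℝ)
    rw [← h]
    exact (Subspace.dual_finrank_eq (K := ℝ) (V := E)).symm
  have hker : LinearMap.ker (A x : E →ₗ[ℝ] E →L[ℝ] ℝ) = ⊥ := LinearMap.ker_eq_bot'.2 hinj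
  let e : E ≃L[ℝ] (E →L[ℝ] ℝ) :=
    (LinearEquiv.ofInjectiveOfFinrankEq (A x : E →ₗ[ℝ] E →L[ℝ] ℝ)
      (LinearMap.ker_eq_bot.1 hker) hdim).toContinuousLinearEquiv
  have he : (e : E →L[ℝ] E →L[ℝ] ℝ) = A x := by ext; rfl
  have hcomplete : CompleteSpace E := FiniteDimensional.complete ℝ E
  -- By equality of dimensions `A x` is invertible, hence so is `A y` for `y` near `x`. There `X y =
  -- (A y)⁻¹ (b y)`, and inversion is smooth at invertible operators.
  have h1 : ContDiffAt ℝ r (fun y => (A y).inverse) x := by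
    refine ContDiffAt.comp (g := ContinuousLinearMap.inverse) x ?_ hA
    rw [← he]
    exact contDiffAt_map_inverse (𝕜 := ℝ) e
  have h2 : ∀ᶠ y in 𝓝 x, ∃ e' : E ≃L[ℝ] (E →L[ℝ] ℝ), (e' : E →L[ℝ] E →L[ℝ] ℝ) = A y := by
    have := e.nhds
    rw [he] at this
    exact hA.continuousAt.preimage_mem_nhds this
  refine (h1.clm_apply hb).congr_of_eventuallyEq ?_
  filter_upwards [hX, h2] with y hy ⟨e', he'⟩
  rw [← hy, ← he', ContinuousLinearMap.inverse_equiv]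
  simp

end Calculus

/-! ## Pullback and exterior derivative in charts -/

section Pullback

variable {m l : ℕ} {M : Type*} [TopologicalSpace M] [ChartedSpace (EuclideanSpace ℝ (Fin m)) M]
  {N : Type*} [TopologicalSpace N] [ChartedSpace (EuclideanSpace ℝ (Fin l)) N]

theorem contMDiffAt_extChartAt_symm_of_mem [IsManifold (𝓡 m) ∞ M] (p : M)
    {y : EuclideanSpace ℝ (Fin m)} (hy : y ∈ (extChartAt (𝓡 m) p).target) :
    ContMDiffAt 𝓘(ℝ, EuclideanSpace ℝ (Fin m)) (𝓡 m) ∞ (extChartAt (𝓡 m) p).symm y :=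
  (contMDiffOn_extChartAt_symm p).contMDiffAt ((isOpen_extChartAt_target p).mem_nhds hy)

theorem contMDiffAt_extChartAt_of_mem [IsManifold (𝓡 m) ∞ M] {p x : M}
    (hx : x ∈ (extChartAt (𝓡 m) p).source) :
    ContMDiffAt (𝓡 m) 𝓘(ℝ, EuclideanSpace ℝ (Fin m)) ∞ (extChartAt (𝓡 m) p) x :=
  contMDiffAt_extChartAt' (by rwa [extChartAt_source] at hx)

theorem mfderiv_extChartAt_comp_symm [IsManifold (𝓡 m) ∞ M] (p : M)
    {y : EuclideanSpace ℝ (Fin m)} (hy : y ∈ (extChartAt (𝓡 m) p).target) :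
    (mfderiv (𝓡 m) 𝓘(ℝ, EuclideanSpace ℝ (Fin m)) (extChartAt (𝓡 m) p)
      ((extChartAt (𝓡 m) p).symm y)).comp
    (mfderiv 𝓘(ℝ, EuclideanSpace ℝ (Fin m)) (𝓡 m) (extChartAt (𝓡 m) p).symm y) =
      ContinuousLinearMap.id ℝ (EuclideanSpace ℝ (Fin m)) := by
  have h := mfderiv_extChartAt_comp_mfderivWithin_extChartAt_symm (I := 𝓡 m) hy
  rwa [ModelWithCorners.Boundaryless.range_eq_univ, mfderivWithin_univ] at h

variable (m l) in
/-- The expression of a map in the charts at `q` and `p`. -/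
noncomputable def localExpr (f : N → M) (q : N) (p : M) :
    EuclideanSpace ℝ (Fin l) → EuclideanSpace ℝ (Fin m) :=
  extChartAt (𝓡 m) p ∘ f ∘ (extChartAt (𝓡 l) q).symm

variable [IsManifold (𝓡 m) ∞ M] [IsManifold (𝓡 l) ∞ N]

theorem contDiffAt_localExpr {f : N → M} {q : N} {p : M} {y : EuclideanSpace ℝ (Fin l)}
    (hy : y ∈ (extChartAt (𝓡 l) q).target)
    (hf : ContMDiffAt (𝓡 l) (𝓡 m) ∞ f ((extChartAt (𝓡 l) q).symm y))
    (hp : f ((extChartAt (𝓡 l) q).symm y) ∈ (extChartAt (𝓡 m) p).source) :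
    ContDiffAt ℝ ∞ (localExpr m l f q p) y :=
  ((contMDiffAt_extChartAt_of_mem hp).comp y
    (hf.comp y (contMDiffAt_extChartAt_symm_of_mem q hy))).contDiffAt

/-- Near `y`, `f` after the inverse chart at `q` equals the inverse chart at `p` after `localExpr`;
both sides are differentiated by the chain rule. -/
theorem mfderiv_comp_mfderiv_extChartAt_symm {f : N → M} {q : N} {p : M}
    {y : EuclideanSpace ℝ (Fin l)} (hy : y ∈ (extChartAt (𝓡 l) q).target)
    (hf : ContMDiffAt (𝓡 l) (𝓡 m) ∞ f ((extChartAt (𝓡 l) q).symm y))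
    (hp : f ((extChartAt (𝓡 l) q).symm y) ∈ (extChartAt (𝓡 m) p).source) :
    (mfderiv (𝓡 l) (𝓡 m) f ((extChartAt (𝓡 l) q).symm y)).comp
      (mfderiv 𝓘(ℝ, EuclideanSpace ℝ (Fin l)) (𝓡 l) (extChartAt (𝓡 l) q).symm y) =
    (mfderiv 𝓘(ℝ, EuclideanSpace ℝ (Fin m)) (𝓡 m) (extChartAt (𝓡 m) p).symm
      (localExpr m l f q p y)).comp (fderiv ℝ (localExpr m l f q p) y) := by
  have hs := contMDiffAt_extChartAt_symm_of_mem q hy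
  have hF := contDiffAt_localExpr hy hf hp
  have ht : localExpr m l f q p y ∈ (extChartAt (𝓡 m) p).target := (extChartAt (𝓡 m) p).map_source hp
  have h1 := mfderiv_comp y (hf.mdifferentiableAt (by simp)) (hs.mdifferentiableAt (by simp))
  have h2 := mfderiv_comp y
    ((contMDiffAt_extChartAt_symm_of_mem p ht).mdifferentiableAt (by simp))
    (hF.contMDiffAt.mdifferentiableAt (by simp))
  rw [mfderiv_eq_fderiv] at h2
  refine h1.symm.trans (Eq.trans ?_ h2)
  refine Filter.EventuallyEq.mfderiv_eq ?_
  have hcont : ContinuousAt (f ∘ (extChartAt (𝓡 l) q).symm) y :=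
    hf.continuousAt.comp hs.continuousAt
  filter_upwards [hcont.preimage_mem_nhds ((isOpen_extChartAt_source p).mem_nhds hp)] with z hz
  exact ((extChartAt (𝓡 m) p).left_inv hz).symm

theorem inChart_pullback_apply {k : ℕ} {f : N → M} (α : DiffForm m M k) {q : N} {p : M}
    {y : EuclideanSpace ℝ (Fin l)} (hy : y ∈ (extChartAt (𝓡 l) q).target)
    (hf : ContMDiffAt (𝓡 l) (𝓡 m) ∞ f ((extChartAt (𝓡 l) q).symm y))
    (hp : f ((extChartAt (𝓡 l) q).symm y) ∈ (extChartAt (𝓡 m) p).source) :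
    (DiffForm.pullback (l := l) f α).inChart q y =
      (α.inChart p (localExpr m l f q p y)).compContinuousLinearMap (fderiv ℝ (localExpr m l f q p) y) := by
  have h := mfderiv_comp_mfderiv_extChartAt_symm hy hf hp
  have hx : (extChartAt (𝓡 m) p).symm (localExpr m l f q p y) = f ((extChartAt (𝓡 l) q).symm y) :=
    (extChartAt (𝓡 m) p).left_inv hp
  ext v
  have h' : ∀ w, mfderiv (𝓡 l) (𝓡 m) f ((extChartAt (𝓡 l) q).symm y)
      (mfderiv 𝓘(ℝ, EuclideanSpace ℝ (Fin l)) (𝓡 l) (extChartAt (𝓡 l) q).symm y w) =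
      mfderiv 𝓘(ℝ, EuclideanSpace ℝ (Fin m)) (𝓡 m) (extChartAt (𝓡 m) p).symm
      (localExpr m l f q p y) (fderiv ℝ (localExpr m l f q p) y w) :=
    fun w => DFunLike.congr_fun h w
  -- The type of `α x` depends on `x`, so the change of base point along `hx` is made by
  -- substituting a variable.
  have key : ∀ x : M, x = f ((extChartAt (𝓡 l) q).symm y) →
      ∀ u : Fin k → EuclideanSpace ℝ (Fin m),
        α (f ((extChartAt (𝓡 l) q).symm y)) u = α x u := by
    rintro x rfl u; rfl
  refine Eq.trans ?_ (key _ hx _)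
  exact congrArg (α (f ((extChartAt (𝓡 l) q).symm y))) (funext fun i => h' (v i))

/-- Smoothness and `extDeriv` depend on the germ of the form at `y`, so equality at the single point
is not enough. -/
theorem inChart_pullback_eventuallyEq {k : ℕ} {f : N → M} (hf : ContMDiff (𝓡 l) (𝓡 m) ∞ f)
    (α : DiffForm m M k) {q : N} {p : M} {y : EuclideanSpace ℝ (Fin l)}
    (hy : y ∈ (extChartAt (𝓡 l) q).target)
    (hp : f ((extChartAt (𝓡 l) q).symm y) ∈ (extChartAt (𝓡 m) p).source) :
    (DiffForm.pullback (l := l) f α).inChart q =ᶠ[𝓝 y] fun z =>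
      (α.inChart p (localExpr m l f q p z)).compContinuousLinearMap
        (fderiv ℝ (localExpr m l f q p) z) := by
  have hcont : ContinuousAt (f ∘ (extChartAt (𝓡 l) q).symm) y :=
    hf.continuous.continuousAt.comp (contMDiffAt_extChartAt_symm_of_mem q hy).continuousAt
  filter_upwards [hcont.preimage_mem_nhds ((isOpen_extChartAt_source p).mem_nhds hp),
    (isOpen_extChartAt_target q).mem_nhds hy] with z hz hz'
  exact inChart_pullback_apply α hz' hf.contMDiffAt hz

omit [IsManifold (𝓡 m) ∞ M] in
theorem DiffForm.IsSmooth.contDiffAt_inChart {k : ℕ} {α : DiffForm m M k} (hα : α.IsSmooth) (p : M)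
    {y : EuclideanSpace ℝ (Fin m)} (hy : y ∈ (extChartAt (𝓡 m) p).target) :
    ContDiffAt ℝ ∞ (α.inChart p) y :=
  (hα p).contDiffAt ((isOpen_extChartAt_target p).mem_nhds hy)

/-- The pullback of a smooth form by a smooth map is smooth. -/
theorem DiffForm.IsSmooth.pullback {k : ℕ} {f : N → M} (hf : ContMDiff (𝓡 l) (𝓡 m) ∞ f)
    {α : DiffForm m M k} (hα : α.IsSmooth) : (DiffForm.pullback (l := l) f α).IsSmooth := by
  intro q y hy
  set p := f ((extChartAt (𝓡 l) q).symm y)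
  have hp : f ((extChartAt (𝓡 l) q).symm y) ∈ (extChartAt (𝓡 m) p).source :=
    mem_extChartAt_source (I := 𝓡 m) p
  have hF := contDiffAt_localExpr hy hf.contMDiffAt hp
  refine ContDiffAt.contDiffWithinAt (ContDiffAt.congr_of_eventuallyEq ?_
    (inChart_pullback_eventuallyEq hf α hy hp))
  exact contDiffAt_compContinuousLinearMap
    (ContDiffAt.comp (g := α.inChart p) y
      (hα.contDiffAt_inChart p ((extChartAt (𝓡 m) p).map_source hp)) hF)
    (hF.fderiv_right (m := ∞) (by simp))

/-- The exterior derivative of a pullback, computed in an arbitrary chart of the target. -/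
theorem d_pullback_apply {k : ℕ} {f : N → M} (hf : ContMDiff (𝓡 l) (𝓡 m) ∞ f)
    {α : DiffForm m M k} (hα : α.IsSmooth) (q : N) {p : M}
    (hp : f q ∈ (extChartAt (𝓡 m) p).source) :
    (DiffForm.pullback (l := l) f α).d q =
      (extDeriv (α.inChart p) (extChartAt (𝓡 m) p (f q))).compContinuousLinearMap
        ((mfderiv (𝓡 m) 𝓘(ℝ, EuclideanSpace ℝ (Fin m)) (extChartAt (𝓡 m) p) (f q)).comp
          (mfderiv (𝓡 l) (𝓡 m) f q)) := by
  set y := extChartAt (𝓡 l) q q with hydef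
  have hy : y ∈ (extChartAt (𝓡 l) q).target := mem_extChartAt_target q
  have hqy : (extChartAt (𝓡 l) q).symm y = q := extChartAt_to_inv q
  have hp' : f ((extChartAt (𝓡 l) q).symm y) ∈ (extChartAt (𝓡 m) p).source := by rwa [hqy]
  have hFy : localExpr m l f q p y = extChartAt (𝓡 m) p (f q) := by
    simp only [localExpr, Function.comp_apply, hqy]
  have ht : extChartAt (𝓡 m) p (f q) ∈ (extChartAt (𝓡 m) p).target :=
    (extChartAt (𝓡 m) p).map_source hp
  have hF := contDiffAt_localExpr hy hf.contMDiffAt hp'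
  have hd : DifferentiableAt ℝ (α.inChart p) (localExpr m l f q p y) := by
    rw [hFy]
    exact (hα.contDiffAt_inChart p ht).differentiableAt (by simp)
  -- Chain rule for the identity `localExpr ∘ chart_q = chart_p ∘ f`, valid near `q`.
  have hcomp : (fderiv ℝ (localExpr m l f q p) y).comp
      (mfderiv (𝓡 l) 𝓘(ℝ, EuclideanSpace ℝ (Fin l)) (extChartAt (𝓡 l) q) q) =
      (mfderiv (𝓡 m) 𝓘(ℝ, EuclideanSpace ℝ (Fin m)) (extChartAt (𝓡 m) p) (f q)).comp
          (mfderiv (𝓡 l) (𝓡 m) f q) := by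
    have h1 := mfderiv_comp q (hF.contMDiffAt.mdifferentiableAt (by simp))
      ((contMDiffAt_extChartAt (I := 𝓡 l) (x := q) (n := ∞)).mdifferentiableAt (by simp))
    have h2 := mfderiv_comp q ((contMDiffAt_extChartAt_of_mem hp).mdifferentiableAt (by simp))
      (hf.contMDiffAt.mdifferentiableAt (x := q) (by simp))
    rw [mfderiv_eq_fderiv] at h1
    refine h1.symm.trans (Eq.trans ?_ h2)
    refine Filter.EventuallyEq.mfderiv_eq ?_
    filter_upwards [extChartAt_source_mem_nhds (I := 𝓡 l) q] with z hz
    exact congrArg (fun x => extChartAt (𝓡 m) p (f x)) ((extChartAt (𝓡 l) q).left_inv hz)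
  have hsm : minSmoothness ℝ 2 ≤ (∞ : WithTop ℕ∞) := by
    rw [minSmoothness_of_isRCLikeNormedField]
    exact WithTop.coe_le_coe.2 le_top
  rw [← hcomp, ← hFy]
  unfold DiffForm.d
  rw [(inChart_pullback_eventuallyEq hf α hy hp').extDeriv_eq, extDeriv_pullback hd hF hsm]
  rfl

/-- The exterior derivative commutes with pullbacks. -/
theorem d_pullback {k : ℕ} {f : N → M} (hf : ContMDiff (𝓡 l) (𝓡 m) ∞ f)
    {α : DiffForm m M k} (hα : α.IsSmooth) :
    (DiffForm.pullback (l := l) f α).d = DiffForm.pullback (l := l) f α.d := by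
  funext q
  rw [d_pullback_apply hf hα q (mem_extChartAt_source (f q))]
  rfl

omit [IsManifold (𝓡 m) ∞ M] in
theorem pullback_id {k : ℕ} (α : DiffForm m M k) : DiffForm.pullback (l := m) (fun x : M => x) α = α := by
  funext q
  have h : mfderiv (𝓡 m) (𝓡 m) (fun x : M => x) q = ContinuousLinearMap.id ℝ _ := mfderiv_id
  rw [DiffForm.pullback, h]
  rfl

/-- The exterior derivative can be computed in any chart. -/
theorem DiffForm.IsSmooth.d_apply {k : ℕ} {α : DiffForm m M k} (hα : α.IsSmooth) {x p : M}
    (hp : x ∈ (extChartAt (𝓡 m) p).source) :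
    α.d x = (extDeriv (α.inChart p) (extChartAt (𝓡 m) p x)).compContinuousLinearMap
        (mfderiv (𝓡 m) 𝓘(ℝ, EuclideanSpace ℝ (Fin m)) (extChartAt (𝓡 m) p) x) := by
  -- Chart independence of `d` is the pullback formula for the identity map, read in two different
  -- charts.
  have h := d_pullback_apply (f := fun x : M => x) contMDiff_id hα x hp
  have h' : mfderiv (𝓡 m) (𝓡 m) (fun x : M => x) x = ContinuousLinearMap.id ℝ _ := mfderiv_id
  rw [pullback_id, h'] at h
  exact h

/-- The differentials of the chart and of its inverse cancel. Smoothness of `dα` and `d(dα) = 0`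
thereby reduce to statements on `ℝ^m`. -/
theorem DiffForm.IsSmooth.inChart_d {k : ℕ} {α : DiffForm m M k} (hα : α.IsSmooth) (p : M) :
    Set.EqOn (α.d.inChart p) (extDeriv (α.inChart p)) (extChartAt (𝓡 m) p).target := by
  intro y hy
  have h := mfderiv_extChartAt_comp_symm p hy
  unfold DiffForm.inChart
  rw [hα.d_apply ((extChartAt (𝓡 m) p).map_target hy), (extChartAt (𝓡 m) p).right_inv hy]
  ext v
  exact congrArg (extDeriv (α.inChart p) y) (funext fun i => DFunLike.congr_fun h (v i))

theorem DiffForm.IsSmooth.d {k : ℕ} {α : DiffForm m M k} (hα : α.IsSmooth) : α.d.IsSmooth := by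
  intro p
  refine ContDiffOn.congr (fun y hy => ?_) (hα.inChart_d p)
  exact (contDiffAt_extDeriv (hα.contDiffAt_inChart p hy)).contDiffWithinAt

theorem DiffForm.IsSmooth.d_d {k : ℕ} {α : DiffForm m M k} (hα : α.IsSmooth) : α.d.d = 0 := by
  funext p
  have hy := mem_extChartAt_target (I := 𝓡 m) p
  have h : α.d.inChart p =ᶠ[𝓝 (extChartAt (𝓡 m) p p)] extDeriv (α.inChart p) :=
    (hα.inChart_d p).eventuallyEq_of_mem ((isOpen_extChartAt_target p).mem_nhds hy)
  have hsm : minSmoothness ℝ 2 ≤ (∞ : WithTop ℕ∞) := by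
    rw [minSmoothness_of_isRCLikeNormedField]
    exact WithTop.coe_le_coe.2 le_top
  rw [DiffForm.d, h.extDeriv_eq, extDeriv_extDeriv_apply (hα.contDiffAt_inChart p hy) hsm]
  rfl

end Pullback

/-! ## Vector fields defined by linear equations -/

section LinearEquation

variable {E : Type*} [NormedAddCommGroup E] [NormedSpace ℝ E]

/-- A `1`-form as a continuous linear map. -/
noncomputable def oneFormCLM (β : E [⋀^Fin 1]→L[ℝ] ℝ) : E →L[ℝ] ℝ :=
  (ContinuousAlternatingMap.ofSubsingleton ℝ E ℝ (0 : Fin 1)).symm β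

theorem oneFormCLM_apply (β : E [⋀^Fin 1]→L[ℝ] ℝ) (v : E) : oneFormCLM β v = β ![v] := by
  refine Eq.trans (b := β fun _ => v) rfl (congrArg β ?_)
  ext i
  rw [Subsingleton.elim i 0]; rfl

/-- A `2`-form as a continuous bilinear map. -/
noncomputable def twoFormCLM [FiniteDimensional ℝ E] (α : E [⋀^Fin 2]→L[ℝ] ℝ) :
    E →L[ℝ] E →L[ℝ] ℝ :=
  LinearMap.toContinuousLinearMap
    { toFun := fun v => oneFormCLM (α.curryLeft v)
      map_add' := fun v w => by ext; simp [oneFormCLM_apply]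
      map_smul' := fun c v => by ext; simp [oneFormCLM_apply] }

theorem twoFormCLM_apply [FiniteDimensional ℝ E] (α : E [⋀^Fin 2]→L[ℝ] ℝ) (v w : E) :
    twoFormCLM α v w = α ![v, w] :=
  oneFormCLM_apply _ _

theorem twoForm_swap {V : Type*} [AddCommGroup V] [Module ℝ V] [TopologicalSpace V]
    (α : V [⋀^Fin 2]→L[ℝ] ℝ) (v w : V) : α ![v, w] = -α ![w, v] := by
  have h := α.toAlternatingMap.map_swap ![w, v] (i := 0) (j := 1) (by decide)
  refine Eq.trans (congrArg α ?_) h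
  ext j; fin_cases j <;> simp

variable {D : Type*} [NormedAddCommGroup D] [NormedSpace ℝ D] [FiniteDimensional ℝ E]

omit [FiniteDimensional ℝ E] in
theorem contDiffAt_apply_form {k : ℕ} {r : WithTop ℕ∞} {α : D → E [⋀^Fin k]→L[ℝ] ℝ} {x : D}
    (hα : ContDiffAt ℝ r α x) (v : Fin k → E) : ContDiffAt ℝ r (fun y => α y v) x :=
  ContDiffAt.comp (g := ContinuousAlternatingMap.apply ℝ E ℝ v) x
    (ContinuousLinearMap.contDiff _).contDiffAt hα

theorem contDiffAt_oneFormCLM {r : WithTop ℕ∞} {β : D → E [⋀^Fin 1]→L[ℝ] ℝ} {x : D}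
    (hβ : ContDiffAt ℝ r β x) : ContDiffAt ℝ r (fun y => oneFormCLM (β y)) x := by
  refine contDiffAt_clm_of_apply fun v => ?_
  simp only [oneFormCLM_apply]
  exact contDiffAt_apply_form hβ _

theorem contDiffAt_twoFormCLM {r : WithTop ℕ∞} {α : D → E [⋀^Fin 2]→L[ℝ] ℝ} {x : D}
    (hα : ContDiffAt ℝ r α x) : ContDiffAt ℝ r (fun y => twoFormCLM (α y)) x := by
  refine contDiffAt_clm_of_apply fun v => contDiffAt_clm_of_apply fun w => ?_
  simp only [twoFormCLM_apply]
  exact contDiffAt_apply_form hα _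

end LinearEquation

section VectorField

variable {m : ℕ} {M : Type*} [TopologicalSpace M] [ChartedSpace (EuclideanSpace ℝ (Fin m)) M]

/-- The expression of a vector field in the chart at `p`. -/
noncomputable def vectorInChart (Y : (x : M) → TangentSpace (𝓡 m) x) (p : M)
    (y : EuclideanSpace ℝ (Fin m)) : EuclideanSpace ℝ (Fin m) :=
  mfderiv (𝓡 m) 𝓘(ℝ, EuclideanSpace ℝ (Fin m)) (extChartAt (𝓡 m) p)
    ((extChartAt (𝓡 m) p).symm y) (Y ((extChartAt (𝓡 m) p).symm y))

variable [IsManifold (𝓡 m) ∞ M]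

theorem mfderiv_symm_mfderiv_apply (p : M) {y : EuclideanSpace ℝ (Fin m)}
    (hy : y ∈ (extChartAt (𝓡 m) p).target)
    (v : TangentSpace (𝓡 m) ((extChartAt (𝓡 m) p).symm y)) :
    mfderiv 𝓘(ℝ, EuclideanSpace ℝ (Fin m)) (𝓡 m) (extChartAt (𝓡 m) p).symm y
      (mfderiv (𝓡 m) 𝓘(ℝ, EuclideanSpace ℝ (Fin m)) (extChartAt (𝓡 m) p)
        ((extChartAt (𝓡 m) p).symm y) v) = v := by
  have h := mfderivWithin_extChartAt_symm_comp_mfderiv_extChartAt (I := 𝓡 m) hy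
  rw [ModelWithCorners.Boundaryless.range_eq_univ, mfderivWithin_univ] at h
  exact DFunLike.congr_fun h v

theorem mfderiv_mfderiv_symm_apply (p : M) {y : EuclideanSpace ℝ (Fin m)}
    (hy : y ∈ (extChartAt (𝓡 m) p).target) (v : EuclideanSpace ℝ (Fin m)) :
    mfderiv (𝓡 m) 𝓘(ℝ, EuclideanSpace ℝ (Fin m)) (extChartAt (𝓡 m) p)
        ((extChartAt (𝓡 m) p).symm y)
      (mfderiv 𝓘(ℝ, EuclideanSpace ℝ (Fin m)) (𝓡 m) (extChartAt (𝓡 m) p).symm y v) = v :=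
  DFunLike.congr_fun (mfderiv_extChartAt_comp_symm p hy) v

/-- The vector field `Y` solving `i_Y α + β(Y) β = γ` has smooth chart expressions, if `α`, `β`
and `γ` are smooth and the equation is uniquely solvable. -/
theorem contDiffAt_vectorInChart {α : DiffForm m M 2} {β γ : DiffForm m M 1}
    (hα : α.IsSmooth) (hβ : β.IsSmooth) (hγ : γ.IsSmooth)
    (hinj : ∀ (x : M) (v : TangentSpace (𝓡 m) x),
      (∀ w : TangentSpace (𝓡 m) x, α x ![v, w] + β x ![v] * β x ![w] = 0) → v = 0)
    {Y : (x : M) → TangentSpace (𝓡 m) x}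
    (hY : ∀ (x : M) (w : TangentSpace (𝓡 m) x),
      α x ![Y x, w] + β x ![Y x] * β x ![w] = γ x ![w])
    (p : M) {y : EuclideanSpace ℝ (Fin m)} (hy : y ∈ (extChartAt (𝓡 m) p).target) :
    ContDiffAt ℝ ∞ (vectorInChart Y p) y := by
  have hα' := contDiffAt_twoFormCLM (hα.contDiffAt_inChart p hy)
  have hβ' := contDiffAt_oneFormCLM (hβ.contDiffAt_inChart p hy)
  have hγ' := contDiffAt_oneFormCLM (hγ.contDiffAt_inChart p hy)
  have e1 : ∀ (δ : DiffForm m M 1) (z : EuclideanSpace ℝ (Fin m)) (v : EuclideanSpace ℝ (Fin m)),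
      oneFormCLM (δ.inChart p z) v = δ ((extChartAt (𝓡 m) p).symm z)
        ![mfderiv 𝓘(ℝ, EuclideanSpace ℝ (Fin m)) (𝓡 m) (extChartAt (𝓡 m) p).symm z v] := by
    intro δ z v
    rw [oneFormCLM_apply]
    refine congrArg (δ ((extChartAt (𝓡 m) p).symm z)) (funext fun i => ?_)
    fin_cases i; rfl
  have e2 : ∀ (z : EuclideanSpace ℝ (Fin m)) (v w : EuclideanSpace ℝ (Fin m)),
      twoFormCLM (α.inChart p z) v w = α ((extChartAt (𝓡 m) p).symm z)
        ![mfderiv 𝓘(ℝ, EuclideanSpace ℝ (Fin m)) (𝓡 m) (extChartAt (𝓡 m) p).symm z v,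
          mfderiv 𝓘(ℝ, EuclideanSpace ℝ (Fin m)) (𝓡 m) (extChartAt (𝓡 m) p).symm z w] := by
    intro z v w
    rw [twoFormCLM_apply]
    refine congrArg (α ((extChartAt (𝓡 m) p).symm z)) (funext fun i => ?_)
    fin_cases i <;> rfl
  refine contDiffAt_of_linear_equation (b := fun z => oneFormCLM (γ.inChart p z))
    (A := fun z => twoFormCLM (α.inChart p z) +
      (oneFormCLM (β.inChart p z)).smulRight (oneFormCLM (β.inChart p z))) (hα'.add ?_) hγ' ?_ ?_
  · refine contDiffAt_clm_of_apply fun v => contDiffAt_clm_of_apply fun w => ?_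
    simp only [ContinuousLinearMap.smulRight_apply, smul_apply]
    exact (hβ'.clm_apply contDiffAt_const).smul (hβ'.clm_apply contDiffAt_const)
  -- Every tangent vector is the image of a vector of `ℝ^m` under the differential of the inverse
  -- chart, so the kernel condition in the chart gives the hypothesis of `hinj`.
  · intro v hv
    have h0 := hinj _ (mfderiv 𝓘(ℝ, EuclideanSpace ℝ (Fin m)) (𝓡 m)
      (extChartAt (𝓡 m) p).symm y v) fun w => by
        obtain ⟨W, rfl⟩ : ∃ W : EuclideanSpace ℝ (Fin m), mfderiv 𝓘(ℝ, EuclideanSpace ℝ (Fin m))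
            (𝓡 m) (extChartAt (𝓡 m) p).symm y W = w :=
          ⟨_, mfderiv_symm_mfderiv_apply p hy w⟩
        have h := DFunLike.congr_fun hv W
        simpa only [add_apply, ContinuousLinearMap.smulRight_apply,
          smul_apply, smul_eq_mul, zero_apply, e1, e2] using h
    rw [← mfderiv_mfderiv_symm_apply p hy v, h0]
    exact map_zero _
  · filter_upwards [(isOpen_extChartAt_target p).mem_nhds hy] with z hz
    ext v
    simp only [add_apply, ContinuousLinearMap.smulRight_apply,
      smul_apply, smul_eq_mul, e1, e2]
    have h := hY ((extChartAt (𝓡 m) p).symm z)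
      (mfderiv 𝓘(ℝ, EuclideanSpace ℝ (Fin m)) (𝓡 m) (extChartAt (𝓡 m) p).symm z v)
    rwa [← mfderiv_symm_mfderiv_apply p hz (Y _)] at h

/-- A vector field with smooth chart expressions is smooth. -/
theorem contMDiff_of_vectorInChart {Y : (x : M) → TangentSpace (𝓡 m) x}
    (hY : ∀ p : M, ContDiffAt ℝ ∞ (vectorInChart Y p) (extChartAt (𝓡 m) p p)) :
    ContMDiff (𝓡 m) (𝓡 m).tangent ∞ (fun x => (⟨x, Y x⟩ : TangentBundle (𝓡 m) M)) := by
  intro p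
  refine (Bundle.contMDiffAt_section p).2 ?_
  refine ContMDiffAt.congr_of_eventuallyEq (f := vectorInChart Y p ∘ extChartAt (𝓡 m) p)
    ((hY p).contMDiffAt.comp p contMDiffAt_extChartAt) ?_
  filter_upwards [extChartAt_source_mem_nhds (I := 𝓡 m) p] with x hx
  have hx' : x ∈ (chartAt (EuclideanSpace ℝ (Fin m)) p).source := by
    rwa [extChartAt_source] at hx
  -- The trivialization of the tangent bundle at `p` acts on fibres as the differential of the chart
  -- at `p`, so the fibre coordinate of `Y` is `vectorInChart Y p`.
  have h := DFunLike.congr_fun (TangentBundle.continuousLinearMapAt_trivializationAt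
    (I := 𝓡 m) hx') (Y x)
  refine Eq.trans ?_ (h.trans ?_)
  · exact (Bundle.Trivialization.continuousLinearMapAt_apply_of_mem ℝ _ (by simpa using hx')
      _).symm
  · have key : ∀ z : M, z = x → mfderiv (𝓡 m) 𝓘(ℝ, EuclideanSpace ℝ (Fin m))
        (extChartAt (𝓡 m) p) x (Y x) = (mfderiv (𝓡 m) 𝓘(ℝ, EuclideanSpace ℝ (Fin m))
        (extChartAt (𝓡 m) p) z (Y z) : EuclideanSpace ℝ (Fin m)) := by
      rintro z rfl; rfl
    exact key _ ((extChartAt (𝓡 m) p).left_inv hx)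

end VectorField

/-! ## Contact forms -/

section Contact

variable {n : ℕ} {M : Type*} [TopologicalSpace M]
  [ChartedSpace (EuclideanSpace ℝ (Fin (2 * n + 1))) M]

theorem IsContactForm.eq_zero_of_kernel {η : DiffForm (2 * n + 1) M 1} (hη : IsContactForm η)
    {p : M} {v : TangentSpace (𝓡 (2 * n + 1)) p}
    (h : ∀ w : TangentSpace (𝓡 (2 * n + 1)) p, η.d p ![v, w] = 0) (h' : η p ![v] = 0) : v = 0 :=
  eq_zero_of_wedge_ne_zero (V := TangentSpace (𝓡 (2 * n + 1)) p) (finrank_tangentSpace p)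
    (hη.volume p) h h'

theorem IsContactForm.d_apply_reeb {η : DiffForm (2 * n + 1) M 1} (hη : IsContactForm η)
    {p : M} (v : TangentSpace (𝓡 (2 * n + 1)) p) : η.d p ![v, reeb η p] = 0 := by
  rw [twoForm_swap, (hη.isReebVector_reeb p).1, neg_zero]

/-- The contact vector field of `H` annihilates `H` along `H = 0`. -/
theorem IsContactForm.differential_contactField {η : DiffForm (2 * n + 1) M 1}
    (hη : IsContactForm η) {H : M → ℝ} {p : M} (hp : H p = 0) :
    differential H p (contactField η H p) = 0 := by
  obtain ⟨h1, h2⟩ := hη.isContactVector_contactField H p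
  -- The contact equation is contracted with `X_H` itself: the left side vanishes by skew-symmetry
  -- and the `η`-term because `η(X_H) = H(p) = 0`.
  have h3 := h1 (contactField η H p)
  have h4 := twoForm_swap (η.d p) (contactField η H p) (contactField η H p)
  rw [h2, hp, mul_zero, add_zero] at h3
  linarith

/-- `dη` is nondegenerate on the tangent spaces of `H = 0`, if `ξ(H) ≠ 0`. -/
theorem IsContactForm.eq_zero_of_tangent {η : DiffForm (2 * n + 1) M 1}
    (hη : IsContactForm η) {H : M → ℝ} {p : M} (hp : H p = 0) (hξ : reebDeriv η H p ≠ 0)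
    {v : TangentSpace (𝓡 (2 * n + 1)) p} (hv : differential H p v = 0)
    (h : ∀ w : TangentSpace (𝓡 (2 * n + 1)) p, differential H p w = 0 → η.d p ![v, w] = 0) :
    v = 0 := by
  have hX := hη.isContactVector_contactField H p
  -- Testing against the tangent vector `X_H` gives `0 = dη(X_H, v) = ξ(H) η(v)`.
  have h0 : η p ![v] = 0 := by
    have h1 := hX.1 v
    rw [twoForm_swap, h _ (hη.differential_contactField hp), hv, neg_zero, zero_add] at h1
    exact (mul_eq_zero.1 h1.symm).resolve_left hξ
  refine hη.eq_zero_of_kernel (fun w => ?_) h0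
  -- With this `c` the vector `w - c ξ` lies in `ker dH`. Since `dη(v, ξ) = 0`, vanishing of `dη(v,
  -- ·)` on `ker dH` extends to all `w`.
  set c := differential H p w / reebDeriv η H p with hc
  have hw : differential H p (w - c • reeb η p) = 0 := by
    have h1 : differential H p (w - c • reeb η p) =
        differential H p w - c * reebDeriv η H p := by
      simp only [differential, reebDeriv, map_sub, map_smul]
      rfl
    rw [h1, hc, div_mul_cancel₀ _ hξ, sub_self]
  have h2 := h _ hw
  have h3 := (η.d p).toAlternatingMap.map_update_add ![v, w] 1 (w - c • reeb η p) (c • reeb η p)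
  have h4 := (η.d p).toAlternatingMap.map_update_smul ![v, w] 1 c (reeb η p)
  have e : ∀ z : TangentSpace (𝓡 (2 * n + 1)) p, Function.update ![v, w] 1 z = ![v, z] := by
    intro z; ext j; fin_cases j <;> simp
  rw [e, e] at h4
  rw [e, e, e, h4, sub_add_cancel] at h3
  have h5 := hη.d_apply_reeb v
  refine h3.trans ?_
  change η.d p ![v, w - c • reeb η p] + c • η.d p ![v, reeb η p] = 0
  rw [h2, h5, smul_zero, add_zero]

variable [IsManifold (𝓡 (2 * n + 1)) ∞ M]

/-- `ξ` solves `i_ξ dη + η(ξ) η = η`. The homogeneous equation has only the zero solution: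
evaluation on `ξ` gives `η(v) = 0`, and then `i_v dη = 0`. -/
theorem IsContactForm.contDiffAt_reeb {η : DiffForm (2 * n + 1) M 1} (hη : IsContactForm η)
    (p : M) {y : EuclideanSpace ℝ (Fin (2 * n + 1))}
    (hy : y ∈ (extChartAt (𝓡 (2 * n + 1)) p).target) :
    ContDiffAt ℝ ∞ (vectorInChart (reeb η) p) y := by
  refine contDiffAt_vectorInChart hη.smooth.d hη.smooth hη.smooth (fun x v h => ?_)
    (fun x w => ?_) p hy
  · have h0 : η x ![v] = 0 := by
      have := h (reeb η x)
      rwa [hη.d_apply_reeb, (hη.isReebVector_reeb x).2, zero_add, mul_one] at this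
    refine hη.eq_zero_of_kernel (fun w => ?_) h0
    simpa [h0] using h w
  · rw [(hη.isReebVector_reeb x).1, (hη.isReebVector_reeb x).2, zero_add, one_mul]

/-- The function `ξ(H)` is smooth. -/
theorem IsContactForm.contMDiff_reebDeriv {η : DiffForm (2 * n + 1) M 1} (hη : IsContactForm η)
    {H : M → ℝ} (hH : ContMDiff (𝓡 (2 * n + 1)) 𝓘(ℝ, ℝ) ∞ H) :
    ContMDiff (𝓡 (2 * n + 1)) 𝓘(ℝ, ℝ) ∞ (reebDeriv η H) := by
  intro p
  have hy := mem_extChartAt_target (I := 𝓡 (2 * n + 1)) p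
  have hHs : ∀ y ∈ (extChartAt (𝓡 (2 * n + 1)) p).target,
      ContDiffAt ℝ ∞ (H ∘ (extChartAt (𝓡 (2 * n + 1)) p).symm) y := fun y hy =>
    (hH.contMDiffAt.comp y (contMDiffAt_extChartAt_symm_of_mem p hy)).contDiffAt
  have hG : ContDiffAt ℝ ∞ (fun y => fderiv ℝ (H ∘ (extChartAt (𝓡 (2 * n + 1)) p).symm) y
      (vectorInChart (reeb η) p y)) (extChartAt (𝓡 (2 * n + 1)) p p) :=
    ((hHs _ hy).fderiv_right (m := ∞) (by simp)).clm_apply (hη.contDiffAt_reeb p hy)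
  refine ContMDiffAt.congr_of_eventuallyEq (hG.contMDiffAt.comp p contMDiffAt_extChartAt) ?_
  filter_upwards [extChartAt_source_mem_nhds (I := 𝓡 (2 * n + 1)) p] with x hx
  have hxt := (extChartAt (𝓡 (2 * n + 1)) p).map_source hx
  have key : ∀ y ∈ (extChartAt (𝓡 (2 * n + 1)) p).target,
      reebDeriv η H ((extChartAt (𝓡 (2 * n + 1)) p).symm y) =
      fderiv ℝ (H ∘ (extChartAt (𝓡 (2 * n + 1)) p).symm) y (vectorInChart (reeb η) p y) := by
    intro y hy
    have h1 := mfderiv_comp y (hH.contMDiffAt.mdifferentiableAt (by simp))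
      ((contMDiffAt_extChartAt_symm_of_mem p hy).mdifferentiableAt (by simp))
    rw [mfderiv_eq_fderiv] at h1
    refine Eq.trans ?_ (DFunLike.congr_fun h1 (vectorInChart (reeb η) p y)).symm
    exact congrArg (mfderiv (𝓡 (2 * n + 1)) 𝓘(ℝ, ℝ) H _)
      (mfderiv_symm_mfderiv_apply p hy (reeb η _)).symm
  have h := key _ hxt
  rw [(extChartAt (𝓡 (2 * n + 1)) p).left_inv hx] at h
  exact h

end Contact

/-! ## Open submanifolds -/

section Opens

/-- The chart of `U` at `q` is the restriction of the chart of `M` at `q`, so the inclusion reads as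
the identity near the image of `q`. -/
theorem mfderiv_opens_val {m : ℕ} {M : Type*} [TopologicalSpace M]
    [ChartedSpace (EuclideanSpace ℝ (Fin m)) M] [IsManifold (𝓡 m) ∞ M]
    (U : TopologicalSpace.Opens M) (q : U) :
    mfderiv (𝓡 m) (𝓡 m) (Subtype.val : U → M) q =
      ContinuousLinearMap.id ℝ (EuclideanSpace ℝ (Fin m)) := by
  have hd : MDifferentiableAt (𝓡 m) (𝓡 m) (Subtype.val : U → M) q :=
    (contMDiff_subtype_val (n := ∞)).contMDiffAt.mdifferentiableAt (by simp)
  rw [hd.mfderiv, ModelWithCorners.Boundaryless.range_eq_univ, fderivWithin_univ]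
  have h : writtenInExtChartAt (𝓡 m) (𝓡 m) q (Subtype.val : U → M) =ᶠ[𝓝 (extChartAt (𝓡 m) q q)]
      id := by
    filter_upwards [extChartAt_target_mem_nhds (I := 𝓡 m) q] with y hy
    exact (extChartAt (𝓡 m) q).right_inv hy
  rw [h.fderiv_eq]
  exact fderiv_id

variable {n : ℕ} {M : Type*} [TopologicalSpace M]
  [ChartedSpace (EuclideanSpace ℝ (Fin (2 * n + 1))) M] [IsManifold (𝓡 (2 * n + 1)) ∞ M]
  {η : DiffForm (2 * n + 1) M 1} (U : TopologicalSpace.Opens M)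

theorem pullback_opens_val {m k : ℕ} {M : Type*} [TopologicalSpace M]
    [ChartedSpace (EuclideanSpace ℝ (Fin m)) M] [IsManifold (𝓡 m) ∞ M]
    (U : TopologicalSpace.Opens M) (α : DiffForm m M k) (q : U) :
    DiffForm.pullback (l := m) (Subtype.val : U → M) α q = α q := by
  rw [DiffForm.pullback, mfderiv_opens_val]
  rfl

theorem d_pullback_opens_val (hη : η.IsSmooth) (q : U) :
    (DiffForm.pullback (l := 2 * n + 1) (Subtype.val : U → M) η).d q = η.d q := by
  rw [d_pullback contMDiff_subtype_val hη, pullback_opens_val]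

/-- The restriction of a contact form to an open subset is a contact form. -/
theorem IsContactForm.pullback_opens_val (hη : IsContactForm η) :
    IsContactForm (n := n) (DiffForm.pullback (Subtype.val : U → M) η) where
  smooth := hη.smooth.pullback contMDiff_subtype_val
  volume q := by
    rw [d_pullback_opens_val U hη.smooth, ContactGeometry.pullback_opens_val]
    exact hη.volume q

theorem differential_opens_val {H : M → ℝ} (hH : ContMDiff (𝓡 (2 * n + 1)) 𝓘(ℝ, ℝ) ∞ H) (q : U)
    (v : EuclideanSpace ℝ (Fin (2 * n + 1))) :
    differential (m := 2 * n + 1) (fun q : U => H q) q v =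
      differential (m := 2 * n + 1) H (q : M) v := by
  have h := mfderiv_comp (I := 𝓡 (2 * n + 1)) (I' := 𝓡 (2 * n + 1)) (I'' := 𝓘(ℝ, ℝ)) q
    (f := (Subtype.val : U → M)) (hH.contMDiffAt.mdifferentiableAt (by simp))
    ((contMDiff_subtype_val (n := ∞)).contMDiffAt.mdifferentiableAt (by simp))
  rw [mfderiv_opens_val] at h
  exact DFunLike.congr_fun h v

/-- The Reeb vector of `η` solves the equations of the restricted form, whose solution is unique. -/
theorem reeb_opens_val (hη : IsContactForm η) (q : U) :
    reeb (n := n) (DiffForm.pullback (Subtype.val : U → M) η) q =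
      (reeb η (q : M) : EuclideanSpace ℝ (Fin (2 * n + 1))) := by
  refine ((hη.pullback_opens_val U).eq_reeb ?_).symm
  constructor
  · intro w
    rw [d_pullback_opens_val U hη.smooth]
    exact (hη.isReebVector_reeb (q : M)).1 w
  · rw [ContactGeometry.pullback_opens_val]
    exact (hη.isReebVector_reeb (q : M)).2

/-- The contact vector field of the restriction of `H` is the restriction of that of `H`. -/
theorem contactField_opens_val (hη : IsContactForm η) {H : M → ℝ}
    (hH : ContMDiff (𝓡 (2 * n + 1)) 𝓘(ℝ, ℝ) ∞ H) (q : U) :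
    contactField (n := n) (DiffForm.pullback (Subtype.val : U → M) η) (fun q => H q) q =
      (contactField η H (q : M) : EuclideanSpace ℝ (Fin (2 * n + 1))) := by
  refine ((hη.pullback_opens_val U).existsUnique_isContactVector _ q).unique
    ((hη.pullback_opens_val U).isContactVector_contactField _ q) ?_
  obtain ⟨h1, h2⟩ := hη.isContactVector_contactField H (q : M)
  have hr : reebDeriv (n := n) (DiffForm.pullback (Subtype.val : U → M) η) (fun q => H q) q =
      reebDeriv η H (q : M) := by
    rw [reebDeriv, reeb_opens_val U hη]
    exact differential_opens_val U hH q _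
  constructor
  · intro w
    rw [d_pullback_opens_val U hη.smooth, hr, ContactGeometry.pullback_opens_val]
    refine (h1 w).trans ?_
    rw [← differential_opens_val U hH q w]
    rfl
  · rw [ContactGeometry.pullback_opens_val]
    exact h2

end Opens

/-! ## Embedded zero loci -/

section Immersion

variable {l m : ℕ} {N : Type*} [TopologicalSpace N] [ChartedSpace (EuclideanSpace ℝ (Fin l)) N]
  {M : Type*} [TopologicalSpace M] [ChartedSpace (EuclideanSpace ℝ (Fin m)) M]

/-- The differential of an immersion is injective. -/
theorem mfderiv_injective_of_isImmersionAt {f : N → M} {q : N}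
    (hf : Manifold.IsImmersionAt (𝓡 l) (𝓡 m) ∞ f q) :
    Function.Injective (mfderiv (𝓡 l) (𝓡 m) f q) := by
  have hd := contMDiffAt_of_mem_maximalAtlas hf.domChart_mem_maximalAtlas hf.mem_domChart_source
  have hc := contMDiffAt_of_mem_maximalAtlas hf.codChart_mem_maximalAtlas hf.mem_codChart_source
  have hds := contMDiffAt_symm_of_mem_maximalAtlas hf.domChart_mem_maximalAtlas
    (hf.domChart.map_source hf.mem_domChart_source)
  -- In the normal form of the immersion, `f` is `u ↦ equiv (u, 0)`. Projecting to the first factor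
  -- gives a smooth local left inverse of `f`, whose differential is a left inverse of `mfderiv f`.
  let P : EuclideanSpace ℝ (Fin m) →L[ℝ] EuclideanSpace ℝ (Fin l) :=
    (ContinuousLinearMap.fst ℝ (EuclideanSpace ℝ (Fin l)) hf.complement).comp
      hf.equiv.symm.toContinuousLinearMap
  have hkey : ∀ x ∈ hf.domChart.source, P (hf.codChart (f x)) = hf.domChart x := by
    intro x hx
    have hx' : hf.domChart x ∈ (hf.domChart.extend (𝓡 l)).target := by
      simpa using hf.domChart.map_source hx
    have h := hf.writtenInCharts hx'
    have h' : hf.codChart (f x) = hf.equiv (hf.domChart x, 0) := by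
      simpa [hf.domChart.left_inv hx] using h
    rw [h']
    simp [P]
  have hr : ContMDiffAt (𝓡 m) (𝓡 l) ∞ (fun z => hf.domChart.symm (P (hf.codChart z))) (f q) := by
    refine ContMDiffAt.comp (f q) (g := hf.domChart.symm) ?_
      (P.contDiff.contMDiff.contMDiffAt.comp (f q) hc)
    simp only [hkey q hf.mem_domChart_source]
    exact hds
  have h1 := mfderiv_comp q (hr.mdifferentiableAt (by simp))
    (hf.contMDiffAt.mdifferentiableAt (by simp))
  have h2 : (fun z => hf.domChart.symm (P (hf.codChart z))) ∘ f =ᶠ[𝓝 q] id := by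
    filter_upwards [hf.domChart.open_source.mem_nhds hf.mem_domChart_source] with x hx
    rw [Function.comp_apply, hkey x hx, hf.domChart.left_inv hx, id]
  rw [h2.mfderiv_eq, mfderiv_id] at h1
  exact Function.LeftInverse.injective fun v => (DFunLike.congr_fun h1 v).symm

end Immersion

section ZeroLocus

variable {n : ℕ} {M : Type*} [TopologicalSpace M]
  [ChartedSpace (EuclideanSpace ℝ (Fin (2 * n + 1))) M] [IsManifold (𝓡 (2 * n + 1)) ∞ M]
  {H : M → ℝ} [ChartedSpace (EuclideanSpace ℝ (Fin (2 * n))) (zeroLocus H)]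
  [IsManifold (𝓡 (2 * n)) ∞ (zeroLocus H)]

omit [IsManifold (𝓡 (2 * n + 1)) ∞ M] [IsManifold (𝓡 (2 * n)) ∞ (zeroLocus H)] in
/-- The tangent space of an embedded zero locus is the kernel of `dH`. -/
theorem exists_mfderiv_val_eq_iff (hH : ContMDiff (𝓡 (2 * n + 1)) 𝓘(ℝ, ℝ) ∞ H)
    (hi : Manifold.IsSmoothEmbedding (𝓡 (2 * n)) (𝓡 (2 * n + 1)) ∞
      (Subtype.val : zeroLocus H → M)) (q : zeroLocus H)
    (hreg : Function.Surjective (mfderiv (𝓡 (2 * n + 1)) 𝓘(ℝ, ℝ) H q))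
    (w : TangentSpace (𝓡 (2 * n + 1)) (q : M)) :
    (∃ v : TangentSpace (𝓡 (2 * n)) q,
      mfderiv (𝓡 (2 * n)) (𝓡 (2 * n + 1)) (Subtype.val : zeroLocus H → M) q v = w) ↔
    differential H (q : M) w = 0 := by
  have hinj := mfderiv_injective_of_isImmersionAt (hi.isImmersion.isImmersionAt q)
  have h1 := mfderiv_comp (I'' := 𝓘(ℝ, ℝ)) q (g := H)
    (hH.contMDiffAt.mdifferentiableAt (by simp))
    (hi.contMDiff.contMDiffAt.mdifferentiableAt (x := q) (by simp))
  have h2 : H ∘ (Subtype.val : zeroLocus H → M) = fun _ => (0 : ℝ) := funext fun x => x.2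
  rw [h2, mfderiv_const] at h1
  let A : EuclideanSpace ℝ (Fin (2 * n)) →ₗ[ℝ] EuclideanSpace ℝ (Fin (2 * n + 1)) :=
    (mfderiv (𝓡 (2 * n)) (𝓡 (2 * n + 1)) (Subtype.val : zeroLocus H → M) q).toLinearMap
  let B : EuclideanSpace ℝ (Fin (2 * n + 1)) →ₗ[ℝ] ℝ :=
    (mfderiv (𝓡 (2 * n + 1)) 𝓘(ℝ, ℝ) H q).toLinearMap
  -- Differentiating `H ∘ i₀ = 0` gives the inclusion. Both spaces have dimension `2 * n`, by
  -- injectivity of `A` and surjectivity of `B`, so they coincide.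
  have hle : LinearMap.range A ≤ LinearMap.ker B := by
    rintro _ ⟨v, rfl⟩
    exact (DFunLike.congr_fun h1 v).symm
  have hA : Module.finrank ℝ (LinearMap.range A) = 2 * n := by
    rw [LinearMap.finrank_range_of_inj (f := A) hinj, finrank_euclideanSpace_fin]
  have hB : Module.finrank ℝ (LinearMap.ker B) = 2 * n := by
    have h3 := LinearMap.finrank_range_add_finrank_ker B
    rw [show LinearMap.range B = ⊤ from LinearMap.range_eq_top.2 hreg, finrank_top, Module.finrank_self,
      finrank_euclideanSpace_fin] at h3
    omega
  have heq := Submodule.eq_of_le_of_finrank_eq hle (hA.trans hB.symm)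
  exact (SetLike.ext_iff.1 heq w : w ∈ LinearMap.range A ↔ w ∈ LinearMap.ker B)

variable {η : DiffForm (2 * n + 1) M 1}

/-- `(M₀, dη₀)` is a symplectic manifold. -/
theorem isSymplecticForm_d_pullback_val (hη : IsContactForm η)
    (hH : ContMDiff (𝓡 (2 * n + 1)) 𝓘(ℝ, ℝ) ∞ H)
    (hreg : ∀ p : M, H p = 0 → Function.Surjective (mfderiv (𝓡 (2 * n + 1)) 𝓘(ℝ, ℝ) H p))
    (hξ : ∀ p : M, H p = 0 → reebDeriv η H p ≠ 0)
    (hi : Manifold.IsSmoothEmbedding (𝓡 (2 * n)) (𝓡 (2 * n + 1)) ∞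
      (Subtype.val : zeroLocus H → M)) :
    IsSymplecticForm (DiffForm.d (DiffForm.pullback (l := 2 * n)
        (Subtype.val : zeroLocus H → M) η)) where
  smooth := (hη.smooth.pullback hi.contMDiff).d
  closed := (hη.smooth.pullback hi.contMDiff).d_d
  nondegenerate q v hv := by
    rw [d_pullback hi.contMDiff hη.smooth] at hv
    have hinj := mfderiv_injective_of_isImmersionAt (hi.isImmersion.isImmersionAt q)
    refine hinj (Eq.trans ?_ (map_zero _).symm)
    refine hη.eq_zero_of_tangent q.2 (hξ q q.2)
      ((exists_mfderiv_val_eq_iff hH hi q (hreg q q.2) _).1 ⟨v, rfl⟩) fun w hw => ?_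
    obtain ⟨u, rfl⟩ := (exists_mfderiv_val_eq_iff hH hi q (hreg q q.2) w).2 hw
    refine Eq.trans (congrArg (η.d (q : M)) (funext fun i => ?_)) (hv u)
    fin_cases i <;> rfl

omit [IsManifold (𝓡 (2 * n + 1)) ∞ M] [IsManifold (𝓡 (2 * n)) ∞ (zeroLocus H)] in
/-- The contact vector field of `H` is tangent to `M₀`. -/
theorem exists_mfderiv_val_eq_contactField (hη : IsContactForm η)
    (hH : ContMDiff (𝓡 (2 * n + 1)) 𝓘(ℝ, ℝ) ∞ H)
    (hreg : ∀ p : M, H p = 0 → Function.Surjective (mfderiv (𝓡 (2 * n + 1)) 𝓘(ℝ, ℝ) H p))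
    (hi : Manifold.IsSmoothEmbedding (𝓡 (2 * n)) (𝓡 (2 * n + 1)) ∞
      (Subtype.val : zeroLocus H → M)) (q : zeroLocus H) :
    ∃ v : TangentSpace (𝓡 (2 * n)) q,
      mfderiv (𝓡 (2 * n)) (𝓡 (2 * n + 1)) (Subtype.val : zeroLocus H → M) q v =
        contactField η H q :=
  (exists_mfderiv_val_eq_iff hH hi q (hreg q q.2) _).2 (hη.differential_contactField q.2)

/-- On vectors tangent to `M₀` the `dH`-term of the contact equation vanishes, leaving `i_Y dη₀ =
ξ(H) η₀`. Nondegeneracy of `dη₀` and smoothness of the right side make `Y` smooth. -/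
theorem contMDiff_of_mfderiv_val_eq_contactField (hη : IsContactForm η)
    (hH : ContMDiff (𝓡 (2 * n + 1)) 𝓘(ℝ, ℝ) ∞ H)
    (hreg : ∀ p : M, H p = 0 → Function.Surjective (mfderiv (𝓡 (2 * n + 1)) 𝓘(ℝ, ℝ) H p))
    (hξ : ∀ p : M, H p = 0 → reebDeriv η H p ≠ 0)
    (hi : Manifold.IsSmoothEmbedding (𝓡 (2 * n)) (𝓡 (2 * n + 1)) ∞
      (Subtype.val : zeroLocus H → M))
    {Y : (q : zeroLocus H) → TangentSpace (𝓡 (2 * n)) q}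
    (hY : ∀ q, mfderiv (𝓡 (2 * n)) (𝓡 (2 * n + 1)) (Subtype.val : zeroLocus H → M) q (Y q) =
        contactField η H q) :
    ContMDiff (𝓡 (2 * n)) (𝓡 (2 * n)).tangent ∞
      (fun q => (⟨q, Y q⟩ : TangentBundle (𝓡 (2 * n)) (zeroLocus H))) := by
  have hω := isSymplecticForm_d_pullback_val hη hH hreg hξ hi
  have hη₀ := hη.smooth.pullback hi.contMDiff
  let γ : DiffForm (2 * n) (zeroLocus H) 1 := fun q =>
    reebDeriv η H (q : M) • DiffForm.pullback (l := 2 * n) (Subtype.val : zeroLocus H → M) η q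
  have hc : ContMDiff (𝓡 (2 * n)) 𝓘(ℝ, ℝ) ∞ (fun q : zeroLocus H => reebDeriv η H (q : M)) :=
    (hη.contMDiff_reebDeriv hH).comp hi.contMDiff
  have hγ : γ.IsSmooth := by
    intro p y hy
    have h1 : ContDiffAt ℝ ∞ ((fun q : zeroLocus H => reebDeriv η H (q : M)) ∘
        (extChartAt (𝓡 (2 * n)) p).symm) y :=
      (hc.contMDiffAt.comp y (contMDiffAt_extChartAt_symm_of_mem p hy)).contDiffAt
    exact (h1.smul (hη₀.contDiffAt_inChart p hy)).contDiffWithinAt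
  -- In the symplectic case no rank-one correction is needed: `contDiffAt_vectorInChart` is applied
  -- with `β = 0`.
  have hzero : (0 : DiffForm (2 * n) (zeroLocus H) 1).IsSmooth := fun p =>
    contDiffOn_const (c := (0 : EuclideanSpace ℝ (Fin (2 * n)) [⋀^Fin 1]→L[ℝ] ℝ))
  refine contMDiff_of_vectorInChart fun p => contDiffAt_vectorInChart hω.smooth hzero hγ
    (fun q v h => hω.nondegenerate q v fun w => ?_) (fun q w => ?_) p (mem_extChartAt_target p)
  · simpa using h w
  · have h1 := (hη.isContactVector_contactField H (q : M)).1
      (mfderiv (𝓡 (2 * n)) (𝓡 (2 * n + 1)) (Subtype.val : zeroLocus H → M) q w)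
    rw [(exists_mfderiv_val_eq_iff hH hi q (hreg q q.2) _).1 ⟨w, rfl⟩, neg_zero, zero_add,
      ← hY q] at h1
    rw [d_pullback hi.contMDiff hη.smooth]
    have h2 : DiffForm.pullback (l := 2 * n) (Subtype.val : zeroLocus H → M) η.d q ![Y q, w] =
        γ q ![w] := by
      refine Eq.trans (Eq.trans (congrArg (η.d (q : M)) (funext fun i => ?_)) h1)
        (congrArg (fun u => reebDeriv η H (q : M) * η (q : M) u) (funext fun i => ?_))
      · fin_cases i <;> rfl
      · fin_cases i; rfl
    rw [h2]
    simp

end ZeroLocus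

/-! ## Regular level sets -/

section RegularValue

/-- A real function with surjective differential is linear in suitable local coordinates. -/
theorem exists_straightening {k : ℕ} {F : EuclideanSpace ℝ (Fin (k + 1)) → ℝ}
    {U : Set (EuclideanSpace ℝ (Fin (k + 1)))} (hU : IsOpen U) (hF : ContDiffOn ℝ ∞ F U)
    {a : EuclideanSpace ℝ (Fin (k + 1))} (ha : a ∈ U)
    (hsurj : Function.Surjective (fderiv ℝ F a)) :
    ∃ G : OpenPartialHomeomorph (EuclideanSpace ℝ (Fin (k + 1))) (EuclideanSpace ℝ (Fin (k + 1))),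
      a ∈ G.source ∧ G.source ⊆ U ∧ ContDiffOn ℝ ∞ G G.source ∧ ContDiffOn ℝ ∞ G.symm G.target ∧
      ∃ Λ : (EuclideanSpace ℝ (Fin k) × ℝ) ≃L[ℝ] EuclideanSpace ℝ (Fin (k + 1)),
        ∀ x, (Λ.symm (G x)).2 = F x := by
  have hFa : ∀ x ∈ U, ContDiffAt ℝ ∞ F x := fun x hx => hF.contDiffAt (hU.mem_nhds hx)
  set f' := fderiv ℝ F a with hf'
  obtain ⟨v, hv⟩ := hsurj 1
  -- Since `f' v = 1`, this correction of the identity satisfies `f' ∘ g = F`, and its derivative at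
  -- `a` is the identity.
  let g : EuclideanSpace ℝ (Fin (k + 1)) → EuclideanSpace ℝ (Fin (k + 1)) :=
    fun x => x + (F x - f' x) • v
  have hg : ∀ x ∈ U, ContDiffAt ℝ ∞ g x := fun x hx =>
    contDiffAt_id.add (((hFa x hx).sub f'.contDiff.contDiffAt).smul contDiffAt_const)
  have hga : HasFDerivAt g ((ContinuousLinearEquiv.refl ℝ (EuclideanSpace ℝ (Fin (k + 1)))) :
      EuclideanSpace ℝ (Fin (k + 1)) →L[ℝ] EuclideanSpace ℝ (Fin (k + 1))) a := by
    have h1 := ((hFa a ha).differentiableAt (by simp)).hasFDerivAt.sub f'.hasFDerivAt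
    have h2 := (hasFDerivAt_id (𝕜 := ℝ) a).add (h1.smul_const v)
    refine h2.congr_fderiv ?_
    ext w
    simp [hf']
  -- Shrinking to points where the derivative of `g` is invertible makes the inverse smooth on the
  -- whole target, not only at `g a`.
  let W : Set (EuclideanSpace ℝ (Fin (k + 1))) := U ∩ {x | ∃ e : EuclideanSpace ℝ (Fin (k + 1)) ≃L[ℝ]
      EuclideanSpace ℝ (Fin (k + 1)), (e : _ →L[ℝ] _) = fderiv ℝ g x}
  have hW : W ∈ 𝓝 a := by
    refine Filter.inter_mem (hU.mem_nhds ha) ?_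
    have h1 : ContinuousAt (fderiv ℝ g) a :=
      ((hg a ha).fderiv_right (m := ∞) (by simp)).continuousAt
    have h2 := ContinuousLinearEquiv.nhds
      (ContinuousLinearEquiv.refl ℝ (EuclideanSpace ℝ (Fin (k + 1))))
    rw [← hga.fderiv] at h2
    exact h1.preimage_mem_nhds h2
  obtain ⟨V, hVW, hV, haV⟩ := mem_nhds_iff.1 hW
  let G₀ := (hg a ha).toOpenPartialHomeomorph g hga (by simp)
  let G := G₀.restrOpen V hV
  have hcoe : ∀ x, G x = g x := fun _ => rfl
  have hsrc : G.source ⊆ V := fun x hx => hx.2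
  refine ⟨G, ⟨(hg a ha).mem_toOpenPartialHomeomorph_source hga (by simp), haV⟩,
    fun x hx => (hVW (hsrc hx)).1, ?_, ?_, ?_⟩
  · exact fun x hx => (hg x (hVW (hsrc hx)).1).contDiffWithinAt
  · intro y hy
    have hx := hVW (hsrc (G.map_target hy))
    obtain ⟨e, he⟩ := hx.2
    refine (G.contDiffAt_symm (f₀' := e) hy ?_ (hg _ hx.1)).contDiffWithinAt
    rw [he]
    exact ((hg _ hx.1).differentiableAt (by simp)).hasFDerivAt
  -- The right inverse `t ↦ t v` of `f'` splits the space as `ℝ × ker f'`, with `f'` as the real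
  -- coordinate; `ker f'` has dimension `k`.
  · let r : ℝ →L[ℝ] EuclideanSpace ℝ (Fin (k + 1)) := ContinuousLinearMap.toSpanSingleton ℝ v
    have hr : Function.RightInverse r f' := fun t => by simp [r, hv]
    let e₁ := ContinuousLinearEquiv.equivOfRightInverse f' r hr
    have hfin : Module.finrank ℝ (EuclideanSpace ℝ (Fin k)) =
        Module.finrank ℝ (LinearMap.ker f'.toLinearMap) := by
      have h3 := LinearMap.finrank_range_add_finrank_ker f'.toLinearMap
      rw [show LinearMap.range f'.toLinearMap = ⊤ from LinearMap.range_eq_top.2 hsurj,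
        finrank_top, Module.finrank_self, finrank_euclideanSpace_fin] at h3
      rw [finrank_euclideanSpace_fin]
      omega
    let e₂ : EuclideanSpace ℝ (Fin k) ≃L[ℝ] LinearMap.ker f'.toLinearMap :=
      ContinuousLinearEquiv.ofFinrankEq hfin
    refine ⟨((ContinuousLinearEquiv.prodComm ℝ _ _).trans
      (((ContinuousLinearEquiv.refl ℝ ℝ).prodCongr e₂).trans e₁.symm)), fun x => ?_⟩
    change (e₁ (g x)).1 = F x
    change f' (x + (F x - f' x) • v) = F x
    rw [map_add, map_smul, hv, smul_eq_mul]
    ring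

variable {k : ℕ} {M : Type*} [TopologicalSpace M]
  [ChartedSpace (EuclideanSpace ℝ (Fin (k + 1))) M] [IsManifold (𝓡 (k + 1)) ∞ M]

variable (k) in
/-- A chart of `M` in which `H` is the last coordinate. -/
structure SliceChart (H : M → ℝ) where
  chart : OpenPartialHomeomorph M (EuclideanSpace ℝ (Fin (k + 1)))
  mem_maximalAtlas : chart ∈ IsManifold.maximalAtlas (𝓡 (k + 1)) ∞ M
  equiv : (EuclideanSpace ℝ (Fin k) × ℝ) ≃L[ℝ] EuclideanSpace ℝ (Fin (k + 1))
  snd_eq : ∀ x ∈ chart.source, (equiv.symm (chart x)).2 = H x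

/-- The chart at `p` is followed by a diffeomorphism straightening the chart expression of `H`; the
composite remains in the maximal atlas. -/
theorem exists_sliceChart {H : M → ℝ} (hH : ContMDiff (𝓡 (k + 1)) 𝓘(ℝ, ℝ) ∞ H) {p : M}
    (hreg : Function.Surjective (mfderiv (𝓡 (k + 1)) 𝓘(ℝ, ℝ) H p)) :
    ∃ s : SliceChart k H, p ∈ s.chart.source := by
  have hsurj : Function.Surjective (fderiv ℝ (H ∘ (extChartAt (𝓡 (k + 1)) p).symm)
      (extChartAt (𝓡 (k + 1)) p p)) := by
    have hd : MDifferentiableAt (𝓡 (k + 1)) 𝓘(ℝ, ℝ) H p :=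
      hH.contMDiffAt.mdifferentiableAt (by simp)
    rw [hd.mfderiv, ModelWithCorners.Boundaryless.range_eq_univ, fderivWithin_univ] at hreg
    exact hreg
  have hF : ContDiffOn ℝ ∞ (H ∘ (extChartAt (𝓡 (k + 1)) p).symm)
      (extChartAt (𝓡 (k + 1)) p).target := fun y hy =>
    (hH.contMDiffAt.comp y
      (contMDiffAt_extChartAt_symm_of_mem p hy)).contDiffAt.contDiffWithinAt
  obtain ⟨G, haG, hGU, hG, hGs, Λ, hΛ⟩ := exists_straightening (isOpen_extChartAt_target p) hF
    (mem_extChartAt_target p) hsurj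
  refine ⟨⟨(chartAt (EuclideanSpace ℝ (Fin (k + 1))) p).trans G, ?_, Λ, fun x hx => ?_⟩,
    ⟨mem_chart_source _ p, haG⟩⟩
  · refine OpenPartialHomeomorph.mem_maximalAtlas_of_contMDiffOn _ ?_ ?_
    · exact ContMDiffOn.comp (g := G) hG.contMDiffOn (contMDiffOn_chart.mono fun x hx => hx.1)
        fun x hx => hx.2
    · exact ContMDiffOn.comp (g := (chartAt (EuclideanSpace ℝ (Fin (k + 1))) p).symm)
        contMDiffOn_chart_symm (hGs.contMDiffOn.mono fun x hx => hx.1) fun x hx => hx.2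
  · refine (hΛ _).trans ?_
    exact congrArg H ((chartAt (EuclideanSpace ℝ (Fin (k + 1))) p).left_inv hx.1)

variable {H : M → ℝ}

/-- The chart of the zero locus induced by a slice chart. -/
noncomputable def SliceChart.restrict (s : SliceChart k H) (q : zeroLocus H) :
    OpenPartialHomeomorph (zeroLocus H) (EuclideanSpace ℝ (Fin k)) where
  toFun x := (s.equiv.symm (s.chart x)).1
  -- On the target the last coordinate `0` is the value of `H`, so the condition holds; `q` is only
  -- a default value elsewhere.
  invFun u := open Classical in
    if h : s.chart.symm (s.equiv (u, 0)) ∈ zeroLocus H then ⟨_, h⟩ else q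
  source := {x | (x : M) ∈ s.chart.source}
  target := {u | s.equiv (u, 0) ∈ s.chart.target}
  map_source' x hx := by
    have h1 : ((s.equiv.symm (s.chart x)).1, (0 : ℝ)) = s.equiv.symm (s.chart x) :=
      Prod.ext rfl ((s.snd_eq x hx).trans x.2).symm
    change s.equiv (_, 0) ∈ s.chart.target
    rw [h1, s.equiv.apply_symm_apply]
    exact s.chart.map_source hx
  map_target' u hu := by
    have h := s.snd_eq _ (s.chart.map_target hu)
    rw [s.chart.right_inv hu, s.equiv.symm_apply_apply] at h
    rw [dif_pos (show s.chart.symm (s.equiv (u, 0)) ∈ zeroLocus H from h.symm)]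
    exact s.chart.map_target hu
  left_inv' x hx := by
    have h1 : ((s.equiv.symm (s.chart x)).1, (0 : ℝ)) = s.equiv.symm (s.chart x) :=
      Prod.ext rfl ((s.snd_eq x hx).trans x.2).symm
    have h2 : s.chart.symm (s.equiv ((s.equiv.symm (s.chart x)).1, 0)) = x := by
      rw [h1, s.equiv.apply_symm_apply, s.chart.left_inv hx]
    rw [dif_pos (by rw [h2]; exact x.2)]
    exact Subtype.ext h2
  right_inv' u hu := by
    have h := s.snd_eq _ (s.chart.map_target hu)
    rw [s.chart.right_inv hu, s.equiv.symm_apply_apply] at h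
    rw [dif_pos (show s.chart.symm (s.equiv (u, 0)) ∈ zeroLocus H from h.symm)]
    simp only [s.chart.right_inv hu, s.equiv.symm_apply_apply]
  open_source := s.chart.open_source.preimage continuous_subtype_val
  open_target := s.chart.open_target.preimage
    (s.equiv.continuous.comp (continuous_id.prodMk continuous_const))
  continuousOn_toFun := (continuous_fst.comp s.equiv.symm.continuous).comp_continuousOn
    (s.chart.continuousOn.comp continuous_subtype_val.continuousOn fun x hx => hx)
  continuousOn_invFun := by
    rw [Topology.IsInducing.subtypeVal.continuousOn_iff]
    refine ContinuousOn.congr (f := fun u => s.chart.symm (s.equiv (u, 0)))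
      (s.chart.continuousOn_symm.comp (s.equiv.continuous.comp
        (continuous_id.prodMk continuous_const)).continuousOn fun u hu => hu) fun u hu => ?_
    have h := s.snd_eq _ (s.chart.map_target hu)
    rw [s.chart.right_inv hu, s.equiv.symm_apply_apply] at h
    simp only [Function.comp_apply]
    rw [dif_pos (show s.chart.symm (s.equiv (u, 0)) ∈ zeroLocus H from h.symm)]

omit [IsManifold (𝓡 (k + 1)) ∞ M] in
theorem SliceChart.val_restrict_symm (s : SliceChart k H) (q : zeroLocus H)
    {u : EuclideanSpace ℝ (Fin k)} (hu : u ∈ (s.restrict q).target) :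
    ((s.restrict q).symm u : M) = s.chart.symm (s.equiv (u, 0)) := by
  have hu' : s.equiv (u, 0) ∈ s.chart.target := hu
  have h := s.snd_eq _ (s.chart.map_target hu')
  rw [s.chart.right_inv hu', s.equiv.symm_apply_apply] at h
  exact congrArg Subtype.val
    (dif_pos (show s.chart.symm (s.equiv (u, 0)) ∈ zeroLocus H from h.symm))

/-- A regular zero locus is an embedded submanifold of codimension one. -/
theorem exists_isSmoothEmbedding_zeroLocus (hH : ContMDiff (𝓡 (k + 1)) 𝓘(ℝ, ℝ) ∞ H)
    (hreg : ∀ p : M, H p = 0 → Function.Surjective (mfderiv (𝓡 (k + 1)) 𝓘(ℝ, ℝ) H p)) :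
    ∃ _ : ChartedSpace (EuclideanSpace ℝ (Fin k)) (zeroLocus H),
      IsManifold (𝓡 k) ∞ (zeroLocus H) ∧
      Manifold.IsSmoothEmbedding (𝓡 k) (𝓡 (k + 1)) ∞ (Subtype.val : zeroLocus H → M) := by
  choose s hs using fun q : zeroLocus H => exists_sliceChart hH (hreg q q.2)
  let c : ChartedSpace (EuclideanSpace ℝ (Fin k)) (zeroLocus H) :=
    { atlas := Set.range fun q => (s q).restrict q
      chartAt := fun q => (s q).restrict q
      mem_chart_source := hs
      chart_mem_atlas := fun q => ⟨q, rfl⟩ }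
  have hM : IsManifold (𝓡 k) ∞ (zeroLocus H) := by
    refine isManifold_of_contDiffOn _ _ _ ?_
    rintro _ _ ⟨q, rfl⟩ ⟨q', rfl⟩
    intro u hu
    have hu1 : u ∈ ((s q).restrict q).target := hu.1.1
    have hu2 := hu.1.2
    have hu1' : (s q).equiv (u, 0) ∈ (s q).chart.target := hu1
    have hu2' : (((s q).restrict q).symm u : M) ∈ (s q').chart.source := hu2
    rw [(s q).val_restrict_symm q hu1] at hu2'
    have h1 := contMDiffAt_symm_of_mem_maximalAtlas (s q).mem_maximalAtlas hu1'
    have h2 := contMDiffAt_of_mem_maximalAtlas (s q').mem_maximalAtlas hu2'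
    have h3 : ContDiffAt ℝ ∞ (fun z => (s q').chart ((s q).chart.symm z)) ((s q).equiv (u, 0)) :=
      (h2.comp _ h1).contDiffAt
    have h4 : ContDiffAt ℝ ∞ (fun u : EuclideanSpace ℝ (Fin k) => (s q).equiv (u, 0)) u :=
      (s q).equiv.contDiff.contDiffAt.comp u (contDiffAt_id.prodMk contDiffAt_const)
    -- A transition map of `M₀` is a transition map between slice charts of `M`, preceded by `u ↦
    -- (u, 0)` and followed by the first projection.
    have h5 : ContDiffAt ℝ ∞ (fun u : EuclideanSpace ℝ (Fin k) =>
        ((s q').equiv.symm ((s q').chart ((s q).chart.symm ((s q).equiv (u, 0))))).1) u :=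
      contDiff_fst.contDiffAt.comp u ((s q').equiv.symm.contDiff.contDiffAt.comp u
        (ContDiffAt.comp (g := fun z => (s q').chart ((s q).chart.symm z)) u h3 h4))
    refine (h5.congr_of_eventuallyEq ?_).contDiffWithinAt
    filter_upwards [((s q).restrict q).open_target.mem_nhds hu1] with z hz
    change ((s q').equiv.symm ((s q').chart (((s q).restrict q).symm z : M))).1 = _
    rw [(s q).val_restrict_symm q hz]
  -- The complement is `ℝ`, the direction of the coordinate `H`: in slice charts the inclusion is
  -- exactly `u ↦ equiv (u, 0)`.
  refine ⟨c, hM, ⟨⟨ℝ, inferInstance, inferInstance, fun q => ?_⟩, Topology.IsEmbedding.subtypeVal⟩⟩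
  refine Manifold.IsImmersionAtOfComplement.mk_of_charts (s q).equiv ((s q).restrict q)
    (s q).chart (hs q) (hs q) (IsManifold.subset_maximalAtlas ⟨q, rfl⟩) (s q).mem_maximalAtlas
    (fun x hx => hx) fun u hu => ?_
  have hu' : u ∈ ((s q).restrict q).target := by simpa using hu
  have hu'' : (s q).equiv (u, 0) ∈ (s q).chart.target := hu'
  change (s q).chart (((s q).restrict q).symm u : M) = (s q).equiv (u, 0)
  rw [(s q).val_restrict_symm q hu', (s q).chart.right_inv hu'']

end RegularValue

end ContactGeometry

theorem mainTheorem12 {n : ℕ} {M : Type*} [TopologicalSpace M] [T2Space M]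
    [SecondCountableTopology M] [ChartedSpace (EuclideanSpace ℝ (Fin (2 * n + 1))) M]
    [IsManifold (𝓡 (2 * n + 1)) ∞ M]
    (η : DiffForm (2 * n + 1) M 1) (hη : IsContactForm η)
    (H : M → ℝ) (hH : ContMDiff (𝓡 (2 * n + 1)) 𝓘(ℝ, ℝ) ∞ H)
    -- `0` is a regular value of `H`
    (hreg : ∀ p : M, H p = 0 →
      Function.Surjective (mfderiv (𝓡 (2 * n + 1)) 𝓘(ℝ, ℝ) H p))
    -- `ξ(H)` does not vanish at any point of `M₀ = H⁻¹(0)`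
    (hξ : ∀ p : M, H p = 0 → reebDeriv η H p ≠ 0) :
    -- `M₀` is a `2n`-dimensional regular (embedded) submanifold of `M`
    (∃ _ : ChartedSpace (EuclideanSpace ℝ (Fin (2 * n))) (zeroLocus H),
      IsManifold (𝓡 (2 * n)) ∞ (zeroLocus H) ∧
      Manifold.IsSmoothEmbedding (𝓡 (2 * n)) (𝓡 (2 * n + 1)) ∞
        (Subtype.val : zeroLocus H → M)) ∧
    -- and, for every structure of regular submanifold on `M₀`:
    (∀ [ChartedSpace (EuclideanSpace ℝ (Fin (2 * n))) (zeroLocus H)]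
      [IsManifold (𝓡 (2 * n)) ∞ (zeroLocus H)],
      Manifold.IsSmoothEmbedding (𝓡 (2 * n)) (𝓡 (2 * n + 1)) ∞
        (Subtype.val : zeroLocus H → M) →
      -- `(M₀, dη₀)` is a symplectic manifold, where `η₀ = i₀^* η`
      IsSymplecticForm (DiffForm.d (DiffForm.pullback (l := 2 * n)
        (Subtype.val : zeroLocus H → M) η)) ∧
      -- `dη₀` is the pullback of `dη`
      DiffForm.d (DiffForm.pullback (Subtype.val : zeroLocus H → M) η) =
        DiffForm.pullback (l := 2 * n) (Subtype.val : zeroLocus H → M) (DiffForm.d η) ∧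
      -- `M₀` is `X_H`-invariant: `X_H(q)` lies in `T_q M₀` for `q ∈ M₀`
      (∀ q : zeroLocus H, ∃ v : TangentSpace (𝓡 (2 * n)) q,
        mfderiv (𝓡 (2 * n)) (𝓡 (2 * n + 1)) (Subtype.val : zeroLocus H → M) q v =
          contactField η H q) ∧
      -- there is a smooth vector field `Y` on `M₀` with `i₀_* ∘ Y = X_H ∘ i₀`
      (∃ Y : (q : zeroLocus H) → TangentSpace (𝓡 (2 * n)) q,
        ContMDiff (𝓡 (2 * n)) (𝓡 (2 * n)).tangent ∞
          (fun q => (⟨q, Y q⟩ : TangentBundle (𝓡 (2 * n)) (zeroLocus H))) ∧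
        ∀ q : zeroLocus H,
          mfderiv (𝓡 (2 * n)) (𝓡 (2 * n + 1)) (Subtype.val : zeroLocus H → M) q (Y q) =
            contactField η H q)) ∧
    -- `(M₁, η₁)` is a contact manifold, where `η₁ = i₁^* η`
    IsContactForm (n := n) (DiffForm.pullback
      (Subtype.val : nonzeroLocus H hH.continuous → M) η) ∧
    -- `i₁_* ∘ X_{H₁} = X_H ∘ i₁`, where `H₁ = i₁^* H`
    (∀ q : nonzeroLocus H hH.continuous,
      mfderiv (𝓡 (2 * n + 1)) (𝓡 (2 * n + 1))
        (Subtype.val : nonzeroLocus H hH.continuous → M) q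
        (contactField (n := n)
          (DiffForm.pullback (Subtype.val : nonzeroLocus H hH.continuous → M) η)
          (fun q => H q) q) =
      contactField η H q) := by
  refine ⟨exists_isSmoothEmbedding_zeroLocus hH hreg, fun hi => ?_, hη.pullback_opens_val _,
    fun q => ?_⟩
  · have hX := exists_mfderiv_val_eq_contactField hη hH hreg hi
    refine ⟨isSymplecticForm_d_pullback_val hη hH hreg hξ hi, d_pullback hi.contMDiff hη.smooth,
      hX, ?_⟩
    -- A pointwise choice suffices: every field `Y` mapped to `X_H` by the inclusion is smooth.
    choose Y hY using hX
    exact ⟨Y, contMDiff_of_mfderiv_val_eq_contactField hη hH hreg hξ hi hY, hY⟩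
  · rw [mfderiv_opens_val]
    exact contactField_opens_val _ hη hH q
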